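/- Let $(M,d)$ be a metric space. For a continuous $f:M\to\mathbb R$ the weak slope $|df|(u)\in[0,\infty]$ at $u\in M$ is the supremum of all $\sigma\in[0,\infty)$ for which there are $\delta>0$ and a continuous map $\eta:B_\delta(u)\times[0,\delta]\to M$ with $d(\eta(v,t),v)\le t$ and $f(\eta(v,t))\le f(v)-\sigma t$ for all $(v,t)\in B_\delta(u)\times[0,\delta]$. For a lower semicontinuous $\mathcal F:M\to\mathbb R\cup\{\infty\}$ let $\operatorname{epi}(\mathcal F)=\{(v,t)\in M\times\mathbb R:\mathcal F(v)\le t\}$ carry the metric $\sqrt{d(v_1,v_2)^2+(t_1-t_2)^2}$, let $\mathscr G_{\mathcal F}(v,t)=t$ on $\operatorname{epi}(\mathcal F)$, and for $\mathcal F(u)<\infty$ and $s=|d\mathscr G_{\mathcal F}|(u,\mathcal F(u))\in[0,1]$ put $|d\mathcal F|(u)=s/\sqrt{1-s^2}$ if $s<1$ and $|d\mathcal F|(u)=\infty$ if $s=1$. A point $u$ with $\mathcal F(u)<\infty$ is critical if $|d\mathcal F|(u)=0$. The genus $\operatorname{gen}S$ of a symmetric set $S\subseteq X\setminus\{0\}$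 in a Banach space $X$ is the least integer $n\ge 0$ for which there is an odd continuous map $S\to\mathbb R^n\setminus\{0\}$, and $\infty$ if there is none (so $\operatorname{gen}\emptyset=0$). **Theorem.** Let $X$ be a real Banach space and let $\mathcal F:X\to\mathbb R\cup\{\infty\}$ be such that - (F1) $\mathcal F$ is lower semicontinuous and even, and $\mathcal F(0)=\infty$; - (F2) $\mathcal F$ is bounded from below; - (F3) (PS) for every $c\in\mathbb R$, each sequence $(u_j)$ in $X$ with $\mathcal F(u_j)\to c$ and $|d\mathcal F|(u_j)\to0$ has a convergent subsequence; - (F4) (epi) for each $b>0$, $\inf\{|d\mathscr G_{\mathcal F}|(u,t):(u,t)\in\operatorname{epi}(\mathcal F),\ \mathcal F(u)<t,\ |t|<b\}>0$; - (F5) for every integer $k\ge1$ there is an injective, continuous, odd map $\Phi:\mathbb S^{k-1}\to X$ on the unit sphere $\mathbb S^{k-1}$ of $\mathbb R^k$ with $\sup_{x\in\mathbb S^{k-1}}\mathcal F(\Phi(x))<\infty$. For $k\ge1$ let $$c_k=\inf_{S\in\mathscr S_k}\sup_{v\in S}\mathcal F(v),\qquad \mathscr S_k=\{S\subseteq X\setminus\{0\}\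 \text{symmetric and compact}:\operatorname{gen}S\ge k\}.$$ Then every $c_k$ is a real number, and there is a sequence of pairs $\pm u_1,\pm u_2,\dots$ of critical points of $\mathcal F$ with $\mathcal F(\pm u_k)=c_k$ for all $k\ge1$. If, moreover, the sublevel sets $\{\mathcal F\le\gamma\}$ are compact for all $\gamma\in\mathbb R$, then $c_k\to\infty$ as $k\to\infty$; for every $k\ge1$ there is some $S\in\mathscr S_k$ with $c_k=\sup_{v\in S}\mathcal F(v)$; and every $S\in\mathscr S_k$ with $c_k=\sup_{v\in S}\mathcal F(v)$ contains a critical point $\tilde u_k$ of $\mathcal F$ with $\mathcal F(\tilde u_k)=c_k$. -/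

import Mathlib

open Set Filter Topology
open scoped NNReal ENNReal

noncomputable section

namespace WeakSlopeTheory

/-- The weak slope `|df|(u) ∈ [0,∞]` of a real functional `f` on a metric space `M`: the
supremum of all `σ ∈ [0,∞)` for which there are `δ > 0` and a continuous map
`η : B_δ(u) × [0,δ] → M` with `d(η(v,t),v) ≤ t` and `f(η(v,t)) ≤ f(v) - σ t`. -/
def weakSlope {M : Type*} [MetricSpace M] (f : M → ℝ) (u : M) : ℝ≥0∞ :=
  ⨆ (σ : ℝ≥0) (_ : ∃ δ : ℝ, 0 < δ ∧ ∃ η : M × ℝ → M,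
      ContinuousOn η (Metric.ball u δ ×ˢ Icc 0 δ) ∧
      ∀ v ∈ Metric.ball u δ, ∀ t ∈ Icc (0 : ℝ) δ,
        dist (η (v, t)) v ≤ t ∧ f (η (v, t)) ≤ f v - σ * t), (σ : ℝ≥0∞)

/-- The epigraph `{(v,t) ∈ M × ℝ : F v ≤ t}`; `WithLp 2` provides the metric
`√(d(v₁,v₂)² + (t₁-t₂)²)`. -/
def epigraph {M : Type*} [MetricSpace M] (F : M → EReal) : Set (WithLp 2 (M × ℝ)) :=
  {p | F p.fst ≤ (p.snd : EReal)}

/-- The projection `(v,t) ↦ t` on the epigraph. -/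
def epiHeight {M : Type*} [MetricSpace M] (F : M → EReal) (p : epigraph F) : ℝ :=
  p.1.snd

/-- The point `(u, F u)` of the epigraph, for `F u < ∞`. -/
def graphPoint {M : Type*} [MetricSpace M] (F : M → EReal) (u : M) (h : F u ≠ ⊤) :
    epigraph F :=
  ⟨WithLp.toLp 2 (u, (F u).toReal), EReal.le_coe_toReal h⟩

open Classical in
/-- The weak slope of a lower semicontinuous `F : M → ℝ ∪ {∞}`. With `s` the weak slope of
the projection of the epigraph onto `ℝ` at `(u, F u)`, it is `s / √(1 - s²)` if `s < 1` and `∞`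
otherwise (always `s ≤ 1`). Outside the domain `{F < ∞}` it is set to `∞`. -/
def lscWeakSlope {M : Type*} [MetricSpace M] (F : M → EReal) (u : M) : ℝ≥0∞ :=
  if h : F u ≠ ⊤ then
    if weakSlope (epiHeight F) (graphPoint F u h) < 1 then
      ENNReal.ofReal ((weakSlope (epiHeight F) (graphPoint F u h)).toReal /
        √(1 - (weakSlope (epiHeight F) (graphPoint F u h)).toReal ^ 2))
    else ⊤
  else ⊤

/-- Critical points in the sense of the weak slope. -/
def IsCriticalPoint {M : Type*} [MetricSpace M] (F : M → EReal) (u : M) : Prop :=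
  lscWeakSlope F u = 0

/-- The Palais-Smale condition at all real levels. -/
def PalaisSmale {M : Type*} [MetricSpace M] (F : M → EReal) : Prop :=
  ∀ (c : ℝ) (u : ℕ → M),
    Tendsto (fun j => F (u j)) atTop (𝓝 (c : EReal)) →
    Tendsto (fun j => lscWeakSlope F (u j)) atTop (𝓝 0) →
    ∃ (φ : ℕ → ℕ) (x : M), StrictMono φ ∧ Tendsto (u ∘ φ) atTop (𝓝 x)

/-- The epigraph condition: for each `b > 0`, the weak slope of the projection of the epigraph
onto `ℝ` is bounded away from `0` on the points `(u,t)` with `F u < t` and `|t| < b`. -/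
def EpiCondition {M : Type*} [MetricSpace M] (F : M → EReal) : Prop :=
  ∀ b : ℝ, 0 < b →
    0 < ⨅ (p : epigraph F) (_ : F p.1.fst < (p.1.snd : EReal) ∧ |p.1.snd| < b),
      weakSlope (epiHeight F) p

/-- The genus of a symmetric set `S ⊆ X \ {0}`: the least `n` such that there is an odd
continuous map `S → ℝⁿ \ {0}`, and `∞` if there is none. (In particular `∅` has genus `0`.) -/
def genus {X : Type*} [NormedAddCommGroup X] (S : Set X) : ℕ∞ :=
  ⨅ (n : ℕ) (_ : ∃ φ : X → EuclideanSpace ℝ (Fin n),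
      ContinuousOn φ S ∧ ∀ x ∈ S, φ (-x) = -φ x ∧ φ x ≠ 0), (n : ℕ∞)

/-- The compact symmetric sets `S ⊆ X \ {0}` with genus at least `k`. -/
def genusClass (X : Type*) [NormedAddCommGroup X] (k : ℕ) : Set (Set X) :=
  {S | 0 ∉ S ∧ (∀ x ∈ S, -x ∈ S) ∧ IsCompact S ∧ (k : ℕ∞) ≤ genus S}

/-- The minimax value `c_k = inf_S sup_{v ∈ S} F v`, `S` ranging over `genusClass X k`. -/
def minimaxValue {X : Type*} [NormedAddCommGroup X] (F : X → EReal) (k : ℕ) : EReal :=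
  ⨅ S ∈ genusClass X k, sSup (F '' S)

end WeakSlopeTheory

end

/-!
The minimax levels are critical because a compact symmetric set that realises a level almost
optimally could otherwise be deformed into a better one, and odd deformations do not lower the
genus. The lower semicontinuous `F` enters only through its epigraph, on which the height function
is continuous and on which `(u, t) ↦ (-u, t)` acts isometrically, without fixed points.

* *Deformation.* If the height function has weak slope larger than `σ` at all points `(g x, T)`, `g`
  an odd map on a compact set with `F ∘ g ≤ T`, then finitely many of the local deformations in the
  definition of the weak slope, made equivariant and run one after the other for times given by an
  even partition of unity, produce an odd map `g'` with `dist (g' x) (g x) ≤ t` and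
  `F ∘ g' ≤ T - σ t` for some `t > 0` (`exists_odd_deformation`). No convexity of the epigraph is
  needed, and the second component can be kept constant on the family because raising a point of
  the epigraph stays in the epigraph.
* *Criticality.* By the Palais–Smale and epigraph conditions and the lower semicontinuity of the weak
  slope, a noncritical level has a neighbourhood where the slope exceeds a fixed `σ > 0`
  (`exists_slope_bound`). Ekeland's principle on the complete space of the pairs `(g, T)` then yields
  a pair that the deformation would improve (`exists_criticalPoint_of_minimaxValue`). For an optimal
  compact set, compactness alone bounds the slope from below on it
  (`exists_criticalPoint_of_optimal`).
* *Genus.* The levels are finite because odd images of the sphere in `ℝᵏ` have genus at least `k`,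
  the Borsuk–Ulam theorem `BorsukUlam.le_of_odd_on_sphere`. It is proved by Ky Fan's parity count of
  alternating simplices (`false_of_antipodal_labelling`), in chains modulo two of fine barycentric
  subdivisions of the cross-polytope. With compact sublevel sets, finiteness of the genus of compact
  sets gives `c_k → ∞`, and extension of odd maps to neighbourhoods shows that the sublevel set at
  height `c_k` is itself optimal.
-/

noncomputable section

namespace BorsukUlam

/-! ### Chains of ordered simplices modulo two -/

/-- Chains modulo two of ordered simplices with vertices in `V`. A simplex is the list of its
vertices, repetitions allowed; the empty list is the simplex of dimension `-1`, so that the chain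
complex is the augmented one. -/
abbrev Chain (V : Type*) : Type _ := List V →₀ ZMod 2

/-- The boundary of a simplex: the sum of the lists obtained by deleting one entry. -/
def boundaryList {V : Type*} : List V → Chain V
  | [] => 0
  | v :: l => Finsupp.single l 1 + Finsupp.lmapDomain (ZMod 2) (ZMod 2) (List.cons v) (boundaryList l)

/-- The boundary operator. -/
def boundary (V : Type*) : Chain V →ₗ[ZMod 2] Chain V :=
  Finsupp.linearCombination (ZMod 2) boundaryList

/-- The cone with apex `b` over a chain. -/
def cone {V : Type*} (b : V) : Chain V →ₗ[ZMod 2] Chain V :=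
  Finsupp.lmapDomain (ZMod 2) (ZMod 2) (List.cons b)

/-- The linear extension of a cochain to chains. -/
def eval {V : Type*} (φ : List V → ZMod 2) : Chain V →ₗ[ZMod 2] ZMod 2 :=
  Finsupp.linearCombination (ZMod 2) φ

/-- The chains all of whose simplices satisfy `P`. -/
def chainsOf {V : Type*} (P : List V → Prop) : Submodule (ZMod 2) (Chain V) :=
  Submodule.span (ZMod 2) ((fun l => Finsupp.single l 1) '' {l | P l})

section Chains

variable {V W : Type*}

@[simp] lemma boundary_single (l : List V) :
    boundary V (Finsupp.single l 1) = boundaryList l := by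
  simp [boundary]

@[simp] lemma cone_single (b : V) (l : List V) :
    cone b (Finsupp.single l 1) = Finsupp.single (b :: l) 1 := by
  simp [cone]

@[simp] lemma eval_single (φ : List V → ZMod 2) (l : List V) :
    eval φ (Finsupp.single l 1) = φ l := by
  simp [eval]

lemma boundaryList_cons (v : V) (l : List V) :
    boundaryList (v :: l) = Finsupp.single l 1 + cone v (boundaryList l) := rfl

lemma chain_hom_ext {M : Type*} [AddCommMonoid M] [Module (ZMod 2) M]
    {S T : Chain V →ₗ[ZMod 2] M}
    (h : ∀ l, S (Finsupp.single l 1) = T (Finsupp.single l 1)) : S = T :=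
  Finsupp.lhom_ext' fun l => LinearMap.ext_ring (h l)

lemma single_mem_chainsOf {P : List V → Prop} {l : List V} (h : P l) :
    Finsupp.single l 1 ∈ chainsOf P :=
  Submodule.subset_span ⟨l, h, rfl⟩

lemma map_mem_chainsOf {P : List V → Prop} {Q : List W → Prop}
    (T : Chain V →ₗ[ZMod 2] Chain W)
    (h : ∀ l, P l → T (Finsupp.single l 1) ∈ chainsOf Q) {c : Chain V} (hc : c ∈ chainsOf P) :
    T c ∈ chainsOf Q := by
  have : chainsOf P ≤ (chainsOf Q).comap T := by
    refine Submodule.span_le.2 ?_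
    rintro _ ⟨l, hl, rfl⟩
    exact h l hl
  exact this hc

lemma chainsOf_mono {P Q : List V → Prop} (h : ∀ l, P l → Q l) {c : Chain V}
    (hc : c ∈ chainsOf P) : c ∈ chainsOf Q :=
  map_mem_chainsOf LinearMap.id (fun l hl => single_mem_chainsOf (h l hl)) hc

lemma eq_of_mem_chainsOf {M : Type*} [AddCommMonoid M] [Module (ZMod 2) M] {P : List V → Prop}
    {S T : Chain V →ₗ[ZMod 2] M}
    (h : ∀ l, P l → S (Finsupp.single l 1) = T (Finsupp.single l 1)) {c : Chain V}
    (hc : c ∈ chainsOf P) : S c = T c := by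
  refine LinearMap.eqOn_span (R := ZMod 2) ?_ hc
  rintro _ ⟨l, hl, rfl⟩
  exact h l hl

lemma boundaryList_mem (l : List V) :
    boundaryList l ∈ chainsOf fun l' => l'.Sublist l ∧ l'.length + 1 = l.length := by
  induction l with
  | nil => exact Submodule.zero_mem _
  | cons v l ih =>
    rw [boundaryList_cons]
    refine Submodule.add_mem _ (single_mem_chainsOf ⟨List.sublist_cons_self _ _, rfl⟩) ?_
    refine map_mem_chainsOf _ (fun l' hl' => ?_) ih
    rw [cone_single]
    exact single_mem_chainsOf ⟨hl'.1.cons_cons v, by simp [hl'.2]⟩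

lemma boundary_cone (b : V) (c : Chain V) :
    boundary V (cone b c) = c + cone b (boundary V c) := by
  have : boundary V ∘ₗ cone b = LinearMap.id + cone b ∘ₗ boundary V :=
    chain_hom_ext fun l => by simp [boundaryList_cons]
  exact LinearMap.congr_fun this c

lemma chain_add_self (c : Chain V) : c + c = 0 := by
  ext l
  exact CharTwo.add_self_eq_zero _

lemma boundary_boundaryList (l : List V) : boundary V (boundaryList l) = 0 := by
  induction l with
  | nil => exact map_zero _
  | cons v l ih =>
    rw [boundaryList_cons, map_add, boundary_single, boundary_cone, ih, map_zero, add_zero,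
      chain_add_self]

/-- The map on chains induced by a map of the vertices. -/
def push (f : V → W) : Chain V →ₗ[ZMod 2] Chain W :=
  Finsupp.lmapDomain (ZMod 2) (ZMod 2) (List.map f)

@[simp] lemma push_single (f : V → W) (l : List V) :
    push f (Finsupp.single l 1) = Finsupp.single (l.map f) 1 := by
  simp [push]

lemma push_cone (f : V → W) (b : V) (c : Chain V) : push f (cone b c) = cone (f b) (push f c) := by
  have : push f ∘ₗ cone b = cone (f b) ∘ₗ push f := chain_hom_ext fun l => by simp
  exact LinearMap.congr_fun this c

lemma push_boundaryList (f : V → W) (l : List V) :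
    push f (boundaryList l) = boundaryList (l.map f) := by
  induction l with
  | nil => exact map_zero _
  | cons v l ih =>
    rw [List.map_cons, boundaryList_cons, boundaryList_cons, map_add, push_cone, ih, push_single]

lemma boundary_push (f : V → W) (c : Chain V) :
    boundary W (push f c) = push f (boundary V c) := by
  have : boundary W ∘ₗ push f = push f ∘ₗ boundary V :=
    chain_hom_ext fun l => by simp [push_boundaryList]
  exact LinearMap.congr_fun this c

lemma eval_push (f : V → W) (φ : List W → ZMod 2) (c : Chain V) :
    eval φ (push f c) = eval (fun l => φ (l.map f)) c := by
  have : eval φ ∘ₗ push f = eval fun l => φ (l.map f) := chain_hom_ext fun l => by simp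
  exact LinearMap.congr_fun this c

lemma eval_cone (b : V) (φ : List V → ZMod 2) (c : Chain V) :
    eval φ (cone b c) = eval (fun l => φ (b :: l)) c := by
  have : eval φ ∘ₗ cone b = eval fun l => φ (b :: l) := chain_hom_ext fun l => by simp
  exact LinearMap.congr_fun this c

lemma eval_boundaryList_cons (φ : List V → ZMod 2) (v : V) (l : List V) :
    eval φ (boundaryList (v :: l)) = φ l + eval (fun m => φ (v :: m)) (boundaryList l) := by
  rw [boundaryList_cons, map_add, eval_single, eval_cone]

/-- The coboundary of a symmetric cochain is symmetric. -/
lemma eval_boundaryList_perm {l l' : List V} (h : l.Perm l') :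
    ∀ {φ : List V → ZMod 2}, (∀ m m', m.Perm m' → φ m = φ m') →
      eval φ (boundaryList l) = eval φ (boundaryList l') := by
  induction h with
  | nil => intros; rfl
  | cons x h ih =>
    intro φ hφ
    rw [eval_boundaryList_cons, eval_boundaryList_cons, hφ _ _ h,
      ih fun m m' hm => hφ _ _ (hm.cons x)]
  | swap x y l =>
    intro φ hφ
    simp only [eval_boundaryList_cons]
    have : (fun m => φ (x :: y :: m)) = fun m => φ (y :: x :: m) :=
      funext fun m => hφ _ _ (List.Perm.swap _ _ _)
    rw [this]
    ring
  | trans _ _ ih₁ ih₂ =>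
    intro φ hφ
    exact (ih₁ hφ).trans (ih₂ hφ)

end Chains

/-! ### Alternating labels -/

/-- The list of signs alternates and starts with `b`. -/
def alternates : Bool → List Bool → Bool
  | _, [] => true
  | b, x :: l => (x == b) && alternates (!b) l

/-- The cochain that is `1` on the alternating lists that start with `b`. -/
def altCochain (b : Bool) (l : List Bool) : ZMod 2 := if alternates b l then 1 else 0

lemma altCochain_cons (b x : Bool) (l : List Bool) :
    altCochain b (x :: l) = if x = b then altCochain (!b) l else 0 := by
  by_cases h : x = b <;> simp [altCochain, alternates, h]

/-- A list of signs that alternates has, among its faces, exactly one that alternates and starts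
with `b`; any other list has an even number of such faces. -/
lemma eval_altCochain_boundaryList (l : List Bool) (b : Bool) :
    eval (altCochain b) (boundaryList l) = altCochain b l + altCochain (!b) l := by
  induction l generalizing b with
  | nil =>
    have : boundaryList ([] : List Bool) = 0 := rfl
    rw [this, map_zero]
    simp only [altCochain, alternates]
    decide
  | cons x l ih =>
    rw [eval_boundaryList_cons, altCochain_cons, altCochain_cons]
    by_cases h : x = b
    · have h' : x ≠ !b := by rw [h]; cases b <;> decide
      have : (fun m => altCochain b (x :: m)) = altCochain (!b) :=
        funext fun m => by rw [altCochain_cons, if_pos h]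
      rw [this, ih, if_pos h, if_neg h', Bool.not_not, add_zero, add_comm, add_assoc,
        CharTwo.add_self_eq_zero, add_zero]
    · have h' : x = !b := by cases x <;> cases b <;> simp_all
      have : (fun m => altCochain b (x :: m)) = 0 :=
        funext fun m => by rw [altCochain_cons, if_neg h]; rfl
      rw [this, if_neg h, if_pos h', Bool.not_not, zero_add]
      have : eval (0 : List Bool → ZMod 2) = 0 := chain_hom_ext fun m => by simp
      rw [this]
      simp

lemma alternates_map_not (b : Bool) (l : List Bool) :
    alternates b (l.map not) = alternates (!b) l := by
  induction l generalizing b with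
  | nil => rfl
  | cons x l ih =>
    simp only [List.map_cons, alternates, ih]
    cases x <;> cases b <;> rfl

section Labels

variable {n : ℕ}

/-- Labels `±1, …, ±n`, ordered by absolute value first. -/
abbrev Label (n : ℕ) : Type := Fin n ×ₗ Bool

/-- The opposite label. -/
def flipLabel (x : Label n) : Label n := toLex ((ofLex x).1, !(ofLex x).2)

/-- A list of labels without a complementary pair. -/
def NonComplementary (l : List (Label n)) : Prop :=
  ∀ x ∈ l, ∀ y ∈ l, (ofLex x).1 = (ofLex y).1 → x = y

/-- The signs of a list of labels, in increasing order of the labels. -/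
def signs (l : List (Label n)) : List Bool :=
  (l.insertionSort (· ≤ ·)).map fun x => (ofLex x).2

/-- Ky Fan's cochain: it is `1` on the lists of labels whose signs, in increasing order of the
labels, alternate and start with `b`. -/
def fanCochain (b : Bool) (l : List (Label n)) : ZMod 2 := altCochain b (signs l)

lemma insertionSort_eq_of_perm {α : Type*} [LinearOrder α] {l l' : List α} (h : l.Perm l') :
    l.insertionSort (· ≤ ·) = l'.insertionSort (· ≤ ·) :=
  List.Perm.eq_of_pairwise (le := (· ≤ ·)) (fun _ _ _ _ h₁ h₂ => le_antisymm h₁ h₂)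
    (List.pairwise_insertionSort _ _) (List.pairwise_insertionSort _ _)
    (((List.perm_insertionSort _ _).trans h).trans (List.perm_insertionSort _ _).symm)

lemma fanCochain_perm (b : Bool) {l l' : List (Label n)} (h : l.Perm l') :
    fanCochain b l = fanCochain b l' := by
  rw [fanCochain, fanCochain, signs, signs, insertionSort_eq_of_perm h]

lemma fanCochain_of_pairwise (b : Bool) {l : List (Label n)} (h : l.Pairwise (· ≤ ·)) :
    fanCochain b l = altCochain b (l.map fun x => (ofLex x).2) := by
  rw [fanCochain, signs, h.insertionSort_eq]

/-- The coboundary of Ky Fan's cochain. -/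
lemma eval_fanCochain_boundaryList (b : Bool) (l : List (Label n)) :
    eval (fanCochain b) (boundaryList l) = fanCochain b l + fanCochain (!b) l := by
  set s := l.insertionSort (· ≤ ·) with hs
  have hls : l.Perm s := (List.perm_insertionSort _ _).symm
  have hsort : s.Pairwise (· ≤ ·) := List.pairwise_insertionSort _ _
  rw [eval_boundaryList_perm hls fun m m' h => fanCochain_perm b h, fanCochain_perm b hls,
    fanCochain_perm (!b) hls, fanCochain_of_pairwise b hsort, fanCochain_of_pairwise (!b) hsort,
    ← eval_altCochain_boundaryList, ← push_boundaryList, eval_push]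
  refine eq_of_mem_chainsOf (fun m hm => ?_) (boundaryList_mem s)
  rw [eval_single, eval_single, fanCochain_of_pairwise b (hsort.sublist hm.1)]

lemma fanCochain_map_flip (b : Bool) {l : List (Label n)} (hl : NonComplementary l) :
    fanCochain b (l.map flipLabel) = fanCochain (!b) l := by
  set s := l.insertionSort (· ≤ ·) with hs
  have hls : l.Perm s := (List.perm_insertionSort _ _).symm
  have hsort : s.Pairwise (· ≤ ·) := List.pairwise_insertionSort _ _
  have hsort' : (s.map flipLabel).Pairwise (· ≤ ·) := by
    rw [List.pairwise_map]
    refine hsort.imp_of_mem fun {x y} hx hy hxy => ?_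
    rcases Prod.Lex.le_iff.1 hxy with h | h
    · exact Prod.Lex.le_iff.2 (Or.inl h)
    · rw [hl x (hls.mem_iff.2 hx) y (hls.mem_iff.2 hy) h.1]
  rw [fanCochain_perm b (hls.map _), fanCochain_perm (!b) hls, fanCochain_of_pairwise b hsort',
    fanCochain_of_pairwise (!b) hsort, List.map_map, altCochain, altCochain, ← alternates_map_not,
    List.map_map]
  rfl

/-- An alternating list of labels without complementary pairs has distinct absolute values. -/
lemma fanCochain_eq_zero (b : Bool) {l : List (Label n)} (hl : NonComplementary l)
    (hn : n < l.length) : fanCochain b l = 0 := by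
  set s := l.insertionSort (· ≤ ·) with hs
  have hls : l.Perm s := (List.perm_insertionSort _ _).symm
  have hsort : s.Pairwise (· ≤ ·) := List.pairwise_insertionSort _ _
  rw [fanCochain_perm b hls, fanCochain_of_pairwise b hsort, altCochain, if_neg]
  intro halt
  have key : ∀ (t : List (Label n)) (b : Bool), t.Pairwise (· ≤ ·) →
      (∀ x ∈ t, ∀ y ∈ t, (ofLex x).1 = (ofLex y).1 → x = y) →
      alternates b (t.map fun x => (ofLex x).2) = true →
      (t.map fun x => (ofLex x).1).IsChain (· < ·) := by
    intro t
    induction t with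
    | nil => intros; exact List.isChain_nil
    | cons x t ih =>
      intro b hp hc ha
      cases t with
      | nil => exact List.isChain_singleton _
      | cons y t =>
        have hxy : x ≤ y := (List.pairwise_cons.1 hp).1 y (by simp)
        simp only [List.map_cons, alternates, Bool.and_eq_true, beq_iff_eq] at ha
        refine List.IsChain.cons_cons ?_ (ih (!b) (List.pairwise_cons.1 hp).2
          (fun u hu v hv => hc u (List.mem_cons_of_mem _ hu) v (List.mem_cons_of_mem _ hv)) ?_)
        · rcases Prod.Lex.le_iff.1 hxy with h | h
          · exact h
          · have := hc x (by simp) y (by simp) h.1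
            rw [this] at ha
            have h2 := ha.1.symm.trans ha.2.1
            cases b <;> simp at h2
        · simp only [List.map_cons, alternates, Bool.and_eq_true, beq_iff_eq]
          exact ha.2
  have hchain := key s b hsort
    (fun x hx y hy => hl x (hls.mem_iff.2 hx) y (hls.mem_iff.2 hy)) halt
  have hnodup : (s.map fun x => (ofLex x).1).Nodup :=
    (List.isChain_iff_pairwise.1 hchain).imp fun h => h.ne
  have := hnodup.length_le_card
  rw [List.length_map, Fintype.card_fin, ← hls.length_eq] at this
  omega

end Labels

/-! ### Ky Fan's parity argument -/

/-- Ky Fan's parity argument. Let `H 0, …, H n` be chains with `∂ H (i + 1) = (1 + ν) H i`, where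
`H 0` is a sum of an odd number of points, as for the hemispheres of a subdivided sphere of
dimension `n`. Then the vertices cannot be labelled by `±1, …, ±n` antipodally such that no simplex
of the chains has a complementary pair of labels. -/
lemma false_of_antipodal_labelling {V : Type*} {n : ℕ} (ν : V → V) (lab : V → Label n)
    (K : Set V) (hlab : ∀ v ∈ K, lab (ν v) = flipLabel (lab v)) (H : ℕ → Chain V)
    (hzero : boundary V (H 0) = Finsupp.single [] 1)
    (hsucc : ∀ i < n, boundary V (H (i + 1)) = H i + push ν (H i))
    (hmem : ∀ i ≤ n, H i ∈ chainsOf fun l =>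
      l.length = i + 1 ∧ (∀ v ∈ l, v ∈ K) ∧ NonComplementary (l.map lab)) : False := by
  have hstep : ∀ i ≤ n, eval (fun l => fanCochain true (l.map lab)) (boundary V (H i)) =
      eval (fun l => fanCochain true (l.map lab)) (H i + push ν (H i)) := by
    intro i hi
    rw [← LinearMap.comp_apply, map_add, eval_push, ← LinearMap.add_apply]
    refine eq_of_mem_chainsOf (fun l hl => ?_) (hmem i hi)
    rw [LinearMap.comp_apply, boundary_single, LinearMap.add_apply, eval_single, eval_single,
      ← eval_push, push_boundaryList, eval_fanCochain_boundaryList]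
    have : (l.map ν).map lab = (l.map lab).map flipLabel := by
      rw [List.map_map, List.map_map]
      exact List.map_congr_left fun v hv => hlab v (hl.2.1 v hv)
    rw [this, fanCochain_map_flip _ hl.2.2]
  have hodd : ∀ i ≤ n,
      eval (fun l => fanCochain true (l.map lab)) (H i + push ν (H i)) = 1 := by
    intro i
    induction i with
    | zero =>
      intro hi
      rw [← hstep 0 hi, hzero, eval_single]
      rfl
    | succ i ih =>
      intro hi
      rw [← hstep (i + 1) hi, hsucc i (by omega)]
      exact ih (by omega)
  have hvanish : eval (fun l => fanCochain true (l.map lab)) (H n + push ν (H n)) = 0 := by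
    rw [map_add, eval_push, ← LinearMap.add_apply]
    refine (eq_of_mem_chainsOf (T := 0) (fun l hl => ?_) (hmem n le_rfl)).trans
      (LinearMap.zero_apply _)
    have : (l.map ν).map lab = (l.map lab).map flipLabel := by
      rw [List.map_map, List.map_map]
      exact List.map_congr_left fun v hv => hlab v (hl.2.1 v hv)
    rw [LinearMap.add_apply, eval_single, eval_single, this, fanCochain_map_flip _ hl.2.2,
      fanCochain_eq_zero _ hl.2.2 (by simp [hl.1]), fanCochain_eq_zero _ hl.2.2 (by simp [hl.1]),
      LinearMap.zero_apply, add_zero]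
  have := hodd n le_rfl
  rw [hvanish] at this
  exact zero_ne_one this

/-! ### Barycentric subdivision -/

section Subdivision

variable {V : Type*} [NormedAddCommGroup V] [NormedSpace ℝ V]

/-- The barycentre of a list of points. -/
def barycenter (l : List V) : V := (l.length : ℝ)⁻¹ • l.sum

/-- The barycentric subdivision of a simplex, the cone from its barycentre over the subdivided
boundary. The recursion is on a number `k`; for simplices with at most `k` vertices the subdivision
is the full one. -/
def subdivList : ℕ → List V → Chain V
  | 0, l => Finsupp.single l 1
  | _ + 1, [] => Finsupp.single [] 1
  | k + 1, v :: l => cone (barycenter (v :: l))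
      (Finsupp.linearCombination (ZMod 2) (subdivList k) (boundaryList (v :: l)))

/-- The linear extension of `subdivList`. -/
def subdiv (k : ℕ) : Chain V →ₗ[ZMod 2] Chain V :=
  Finsupp.linearCombination (ZMod 2) (subdivList k)

@[simp] lemma subdiv_single (k : ℕ) (l : List V) :
    subdiv k (Finsupp.single l 1) = subdivList k l := by
  simp [subdiv]

lemma subdivList_succ_cons (k : ℕ) (v : V) (l : List V) :
    subdivList (k + 1) (v :: l) =
      cone (barycenter (v :: l)) (subdiv k (boundaryList (v :: l))) := rfl

lemma boundary_subdiv_succ (k : ℕ) (c : Chain V) :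
    boundary V (subdiv (k + 1) c) = subdiv k (boundary V c) := by
  induction k generalizing c with
  | zero =>
    have h0 : subdiv 0 = (LinearMap.id : Chain V →ₗ[ZMod 2] Chain V) :=
      chain_hom_ext fun l => by rw [subdiv_single]; rfl
    have : boundary V ∘ₗ subdiv 1 = subdiv 0 ∘ₗ boundary V := by
      refine chain_hom_ext fun l => ?_
      simp only [LinearMap.comp_apply, subdiv_single, boundary_single, h0, LinearMap.id_apply]
      cases l with
      | nil => exact boundary_single _
      | cons v l =>
        rw [subdivList_succ_cons, boundary_cone, h0, LinearMap.id_apply, boundary_boundaryList,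
          map_zero, add_zero]
    exact LinearMap.congr_fun this c
  | succ k ih =>
    have : boundary V ∘ₗ subdiv (k + 2) = subdiv (k + 1) ∘ₗ boundary V := by
      refine chain_hom_ext fun l => ?_
      simp only [LinearMap.comp_apply, subdiv_single, boundary_single]
      cases l with
      | nil => exact (boundary_single _).trans (map_zero _).symm
      | cons v l =>
        rw [subdivList_succ_cons, boundary_cone, ih, boundary_boundaryList, map_zero, map_zero,
          add_zero]
    exact LinearMap.congr_fun this c

lemma barycenter_neg (l : List V) : barycenter (l.map fun v => -v) = -barycenter l := by
  have : (l.map fun v => -v).sum = -l.sum := by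
    induction l with
    | nil => simp
    | cons v l ih => simp [ih, add_comm]
  rw [barycenter, barycenter, this, List.length_map, smul_neg]

lemma subdiv_push_neg (k : ℕ) (c : Chain V) :
    subdiv k (push (fun v => -v) c) = push (fun v => -v) (subdiv k c) := by
  have : subdiv k ∘ₗ push (fun v : V => -v) = push (fun v => -v) ∘ₗ subdiv k := by
    induction k with
    | zero =>
      refine chain_hom_ext fun l => ?_
      simp [subdivList]
    | succ k ih =>
      refine chain_hom_ext fun l => ?_
      simp only [LinearMap.comp_apply, subdiv_single, push_single]
      cases l with
      | nil => simp [subdivList]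
      | cons v l =>
        rw [List.map_cons, subdivList_succ_cons, subdivList_succ_cons, push_cone,
          ← List.map_cons, barycenter_neg, ← push_boundaryList]
        congr 1
        exact LinearMap.congr_fun ih _
  exact LinearMap.congr_fun this c

/-- The barycentre of `m ≤ N` points at mutual distance at most `d` has distance at most
`(1 - 1 / N) * d` from each of them. -/
lemma dist_barycenter_le {l : List V} {d : ℝ} {N : ℕ} (hN : l.length ≤ N)
    (hd : ∀ u ∈ l, ∀ v ∈ l, dist u v ≤ d) {v : V} (hv : v ∈ l) :
    dist (barycenter l) v ≤ (1 - 1 / N) * d := by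
  classical
  have hd0 : 0 ≤ d := dist_nonneg.trans (hd v hv v hv)
  have hperm : l.Perm (v :: l.erase v) := List.perm_cons_erase hv
  have hlen : l.length = (l.erase v).length + 1 := by simpa using hperm.length_eq
  have hsum : l.sum = v + (l.erase v).sum := by simpa using hperm.sum_eq
  have hbound : ∀ s : List V, (∀ u ∈ s, u ∈ l) →
      ‖s.sum - (s.length : ℝ) • v‖ ≤ s.length * d := by
    intro s
    induction s with
    | nil => simp
    | cons u s ih =>
      intro hs
      have h1 : ‖u - v‖ ≤ d := by
        rw [← dist_eq_norm]; exact hd u (hs u (by simp)) v hv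
      have h2 := ih fun w hw => hs w (by simp [hw])
      have : (u :: s).sum - (((u :: s).length : ℕ) : ℝ) • v =
          (u - v) + (s.sum - (s.length : ℝ) • v) := by
        simp only [List.sum_cons, List.length_cons, Nat.cast_add, Nat.cast_one, add_smul, one_smul]
        abel
      rw [this]
      refine (norm_add_le _ _).trans ?_
      push_cast [List.length_cons]
      linarith
  have hm : (0 : ℝ) < l.length := by rw [hlen]; positivity
  have hNpos : (0 : ℝ) < N := hm.trans_le (by exact_mod_cast hN)
  have heq : barycenter l - v =
      (l.length : ℝ)⁻¹ • ((l.erase v).sum - ((l.erase v).length : ℝ) • v) := by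
    have hlenR : (l.length : ℝ) = (l.erase v).length + 1 := by exact_mod_cast hlen
    have : (l.erase v).sum - ((l.erase v).length : ℝ) • v = l.sum - (l.length : ℝ) • v := by
      rw [hsum, hlenR, add_smul, one_smul]
      abel
    rw [this, smul_sub, smul_smul, inv_mul_cancel₀ hm.ne', one_smul, barycenter]
  rw [dist_eq_norm, heq, norm_smul, norm_inv, Real.norm_natCast]
  have h3 := hbound (l.erase v) fun u hu => List.mem_of_mem_erase hu
  have h4 : ((l.erase v).length : ℝ) = l.length - 1 := by
    have : (l.length : ℝ) = (l.erase v).length + 1 := by exact_mod_cast hlen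
    linarith
  rw [h4] at h3
  calc (l.length : ℝ)⁻¹ * ‖(l.erase v).sum - ((l.erase v).length : ℝ) • v‖
      ≤ (l.length : ℝ)⁻¹ * ((l.length - 1) * d) := by rw [h4]; gcongr
    _ = (1 - 1 / l.length) * d := by field_simp
    _ ≤ (1 - 1 / N) * d := by gcongr

lemma barycenter_mem {l : List V} (hl : l ≠ []) {C : Set V} (hC : Convex ℝ C)
    (h : ∀ v ∈ l, v ∈ C) : barycenter l ∈ C := by
  have hlen : (0 : ℝ) < l.length := by
    exact_mod_cast List.length_pos_iff.2 hl
  have hsum : l.sum = ∑ i : Fin l.length, l.get i := by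
    rw [← List.sum_ofFn, List.ofFn_get]
  rw [barycenter, hsum, Finset.smul_sum]
  refine hC.sum_mem (fun _ _ => by positivity) ?_ fun i _ => h _ (List.get_mem _ _)
  simp [hlen.ne']

/-- Subdivision keeps simplices inside convex sets and shrinks their diameter. -/
lemma subdivList_mem {N k : ℕ} {l : List V} (hk : l.length ≤ k) (hN : l.length ≤ N) {C : Set V}
    (hC : Convex ℝ C) (hlC : ∀ v ∈ l, v ∈ C) {d : ℝ} (hd : ∀ u ∈ l, ∀ v ∈ l, dist u v ≤ d) :
    subdivList k l ∈ chainsOf fun l' => l'.length = l.length ∧ (∀ v ∈ l', v ∈ C) ∧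
      ∀ u ∈ l', ∀ v ∈ l', dist u v ≤ (1 - 1 / N) * d := by
  induction k generalizing l C with
  | zero =>
    have : l = [] := List.length_eq_zero_iff.1 (by omega)
    subst this
    exact single_mem_chainsOf (by simp)
  | succ k ih =>
    cases l with
    | nil => exact single_mem_chainsOf (by simp)
    | cons w l =>
      set L := w :: l with hL
      have hLne : L ≠ [] := by simp [hL]
      have hd0 : 0 ≤ d := dist_nonneg.trans (hd w (by simp [hL]) w (by simp [hL]))
      have hN1 : (1 : ℝ) ≤ N := by
        have : 1 ≤ L.length := by simp [hL]
        exact_mod_cast this.trans hN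
      have hfac : 0 ≤ (1 - 1 / N) * d := by
        refine mul_nonneg ?_ hd0
        rw [sub_nonneg, div_le_one (by linarith)]
        exact hN1
      have hconv : Convex ℝ (C ∩ convexHull ℝ {v | v ∈ L}) := hC.inter (convex_convexHull _ _)
      have hball : convexHull ℝ {v | v ∈ L} ⊆
          Metric.closedBall (barycenter L) ((1 - 1 / N) * d) := by
        refine convexHull_min (fun v hv => ?_) (convex_closedBall _ _)
        rw [Metric.mem_closedBall, dist_comm]
        exact dist_barycenter_le hN hd hv
      rw [subdivList_succ_cons, ← hL]
      have hmem : subdiv k (boundaryList L) ∈ chainsOf fun l' => l'.length + 1 = L.length ∧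
          (∀ v ∈ l', v ∈ C ∩ convexHull ℝ {v | v ∈ L}) ∧
          ∀ u ∈ l', ∀ v ∈ l', dist u v ≤ (1 - 1 / N) * d := by
        refine map_mem_chainsOf _ (fun l' hl' => ?_) (boundaryList_mem L)
        rw [subdiv_single]
        refine chainsOf_mono (fun m hm => ⟨?_, hm.2⟩)
          (ih (l := l') (by omega) (by omega) hconv (fun v hv => ?_) (fun u hu v hv => ?_))
        · exact ⟨hlC v (hl'.1.subset hv), subset_convexHull _ _ (hl'.1.subset hv)⟩
        · exact hd u (hl'.1.subset hu) v (hl'.1.subset hv)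
        · rw [hm.1]; exact hl'.2
      refine map_mem_chainsOf _ (fun m hm => ?_) hmem
      rw [cone_single]
      have hbm : ∀ v ∈ m, dist (barycenter L) v ≤ (1 - 1 / N) * d := fun v hv => by
        have := hball (hm.2.1 v hv).2
        rwa [Metric.mem_closedBall, dist_comm] at this
      refine single_mem_chainsOf ⟨by simpa using hm.1, ?_, ?_⟩
      · intro v hv
        rcases List.mem_cons.1 hv with rfl | hv
        · exact barycenter_mem hLne hC hlC
        · exact (hm.2.1 v hv).1
      · intro u hu v hv
        rcases List.mem_cons.1 hu with rfl | hu <;> rcases List.mem_cons.1 hv with rfl | hv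
        · rw [dist_self]; exact hfac
        · exact hbm v hv
        · rw [dist_comm]; exact hbm u hu
        · exact hm.2.2 u hu v hv

end Subdivision

/-! ### The cross-polytope and the Borsuk–Ulam theorem -/

section Hemispheres

variable {V : Type*} [AddCommGroup V]

/-- The hemispheres of the cross-polytope with vertices `±e 0, ±e 1, …`: the hemisphere of
dimension `i + 1` is the cone with apex `e (i + 1)` over the sphere of dimension `i`. -/
def hemisphere (e : ℕ → V) : ℕ → Chain V
  | 0 => Finsupp.single [e 0] 1
  | i + 1 => cone (e (i + 1)) (hemisphere e i + push (fun v => -v) (hemisphere e i))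

lemma push_neg_push_neg (c : Chain V) :
    push (fun v => -v) (push (fun v => -v) c) = c := by
  have : push (fun v : V => -v) ∘ₗ push (fun v => -v) = LinearMap.id :=
    chain_hom_ext fun l => by
      simp [List.map_map]
  exact LinearMap.congr_fun this c

lemma boundary_hemisphere_zero (e : ℕ → V) :
    boundary V (hemisphere e 0) = Finsupp.single [] 1 := by
  rw [hemisphere, boundary_single, boundaryList_cons]
  exact (congrArg _ (map_zero _)).trans (add_zero _)

lemma boundary_hemisphere_succ (e : ℕ → V) (i : ℕ) :
    boundary V (hemisphere e (i + 1)) =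
      hemisphere e i + push (fun v => -v) (hemisphere e i) := by
  have hcycle : boundary V (hemisphere e i + push (fun v => -v) (hemisphere e i)) = 0 := by
    induction i with
    | zero =>
      rw [map_add, boundary_push, boundary_hemisphere_zero, push_single, List.map_nil,
        chain_add_self]
    | succ i ih =>
      rw [map_add, boundary_push, hemisphere, boundary_cone, ih, map_zero, add_zero, map_add,
        push_neg_push_neg, add_comm (push _ _), chain_add_self]
  rw [hemisphere, boundary_cone, hcycle, map_zero, add_zero]

end Hemispheres

/-- The face of the cross-polytope in the orthant given by the signs `ε`. -/
def crossFace {k : ℕ} (ε : Fin k → ℝ) : Set (EuclideanSpace ℝ (Fin k)) :=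
  {v | (∀ j, 0 ≤ ε j * v j) ∧ ∑ j, ε j * v j = 1}

lemma convex_crossFace {k : ℕ} (ε : Fin k → ℝ) : Convex ℝ (crossFace ε) := by
  intro u hu v hv a b ha hb hab
  refine ⟨fun j => ?_, ?_⟩
  · have : ε j * (a • u + b • v) j = a * (ε j * u j) + b * (ε j * v j) := by
      simp only [PiLp.add_apply, PiLp.smul_apply, smul_eq_mul]; ring
    rw [this]
    have := hu.1 j
    have := hv.1 j
    positivity
  · have : ∀ j, ε j * (a • u + b • v) j = a * (ε j * u j) + b * (ε j * v j) := fun j => by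
      simp only [PiLp.add_apply, PiLp.smul_apply, smul_eq_mul]; ring
    simp only [this, Finset.sum_add_distrib, ← Finset.mul_sum, hu.2, hv.2]
    linarith

/-- The boundary of the cross-polytope. -/
def crossSphere (k : ℕ) : Set (EuclideanSpace ℝ (Fin k)) := {v | ∑ j, |v j| = 1}

lemma crossFace_subset {k : ℕ} {ε : Fin k → ℝ} (hε : ∀ j, |ε j| = 1) :
    crossFace ε ⊆ crossSphere k := by
  intro v hv
  have : ∀ j, |v j| = ε j * v j := fun j => by
    rw [← abs_of_nonneg (hv.1 j), abs_mul, hε j, one_mul]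
  simp only [crossSphere, mem_ofPred_eq, this]
  exact hv.2

lemma isCompact_crossSphere (k : ℕ) : IsCompact (crossSphere k) := by
  refine Metric.isCompact_of_isClosed_isBounded ?_ ?_
  · exact isClosed_eq (by fun_prop) continuous_const
  · refine (Metric.isBounded_iff_subset_closedBall 0).2 ⟨√k, fun v hv => ?_⟩
    rw [mem_closedBall_zero_iff, EuclideanSpace.norm_eq]
    refine Real.sqrt_le_sqrt ?_
    have : ∀ j, ‖v j‖ ^ 2 ≤ 1 := fun j => by
      have h1 : |v j| ≤ 1 := by
        rw [← show ∑ j, |v j| = 1 from hv]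
        exact Finset.single_le_sum (f := fun j => |v j|) (fun _ _ => abs_nonneg _)
          (Finset.mem_univ j)
      rw [Real.norm_eq_abs]
      exact pow_le_one₀ (abs_nonneg _) h1
    calc ∑ j, ‖v j‖ ^ 2 ≤ ∑ _j : Fin k, (1 : ℝ) := Finset.sum_le_sum fun j _ => this j
      _ = k := by simp

lemma ne_zero_of_mem_crossSphere {k : ℕ} {v : EuclideanSpace ℝ (Fin k)}
    (hv : v ∈ crossSphere k) : v ≠ 0 := by
  rintro rfl
  simp [crossSphere] at hv

/-- The standard basis of `ℝᵏ`, continued by zero. -/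
def basisVec (k i : ℕ) : EuclideanSpace ℝ (Fin k) :=
  WithLp.toLp 2 fun j => if (j : ℕ) = i then 1 else 0

lemma hemisphere_mem {k i : ℕ} (hi : i < k) :
    hemisphere (basisVec k) i ∈ chainsOf fun l => l.length = i + 1 ∧
      ∃ ε : Fin k → ℝ, (∀ j, |ε j| = 1) ∧ ∀ v ∈ l, v ∈ crossFace ε ∧
        ∀ j : Fin k, i < j → v j = 0 := by
  have hbasis : ∀ i (hi : i < k) (ε : Fin k → ℝ), ε ⟨i, hi⟩ = 1 → basisVec k i ∈ crossFace ε := by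
    intro i hi ε hε
    have : ∀ j : Fin k, ε j * (basisVec k i) j = if j = ⟨i, hi⟩ then 1 else 0 := by
      intro j
      by_cases hj : j = ⟨i, hi⟩
      · subst hj; simp [basisVec, hε]
      · have : (j : ℕ) ≠ i := fun h => hj (Fin.ext h)
        simp [basisVec, hj, this]
    refine ⟨fun j => ?_, ?_⟩
    · rw [this]; split_ifs <;> norm_num
    · simp [this]
  induction i with
  | zero =>
    refine single_mem_chainsOf ⟨rfl, fun _ => 1, fun _ => by norm_num, ?_⟩
    intro v hv
    rw [List.mem_singleton] at hv
    subst hv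
    refine ⟨hbasis 0 hi _ rfl, fun j hj => ?_⟩
    have : (j : ℕ) ≠ 0 := by omega
    simp [basisVec, this]
  | succ i ih =>
    have ih := ih (by omega)
    have hsum : hemisphere (basisVec k) i + push (fun v => -v) (hemisphere (basisVec k) i) ∈
        chainsOf fun l => l.length = i + 1 ∧ ∃ ε : Fin k → ℝ, (∀ j, |ε j| = 1) ∧
          ∀ v ∈ l, v ∈ crossFace ε ∧ ∀ j : Fin k, i < j → v j = 0 := by
      refine Submodule.add_mem _ ih (map_mem_chainsOf _ (fun l hl => ?_) ih)
      obtain ⟨hlen, ε, hε, hv⟩ := hl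
      rw [push_single]
      refine single_mem_chainsOf ⟨by simp [hlen], fun j => -ε j, fun j => by rw [abs_neg, hε], ?_⟩
      intro v hv'
      obtain ⟨w, hw, rfl⟩ := List.mem_map.1 hv'
      obtain ⟨⟨h1, h2⟩, h3⟩ := hv w hw
      refine ⟨⟨fun j => ?_, ?_⟩, fun j hj => ?_⟩
      · simpa using h1 j
      · simpa using h2
      · simp [h3 j hj]
    refine map_mem_chainsOf _ (fun l hl => ?_) hsum
    obtain ⟨hlen, ε, hε, hv⟩ := hl
    rw [cone_single]
    -- The sign in the direction of the new vertex is free, as all old vertices vanish there.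
    refine single_mem_chainsOf ⟨by simp [hlen], Function.update ε ⟨i + 1, hi⟩ 1, fun j => ?_, ?_⟩
    · by_cases hj : j = ⟨i + 1, hi⟩
      · subst hj; simp
      · rw [Function.update_of_ne hj]; exact hε j
    · intro v hv'
      rcases List.mem_cons.1 hv' with rfl | hv'
      · refine ⟨hbasis (i + 1) hi _ (by simp), fun j hj => ?_⟩
        have : (j : ℕ) ≠ i + 1 := by omega
        simp [basisVec, this]
      · obtain ⟨⟨h1, h2⟩, h3⟩ := hv v hv'
        have : ∀ j, Function.update ε ⟨i + 1, hi⟩ 1 j * v j = ε j * v j := by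
          intro j
          by_cases hj : j = ⟨i + 1, hi⟩
          · subst hj; rw [h3 _ (by simp)]; simp
          · rw [Function.update_of_ne hj]
        refine ⟨⟨fun j => by rw [this]; exact h1 j, by simp only [this]; exact h2⟩,
          fun j hj => h3 j (by omega)⟩

/-- Arbitrarily fine subdivisions of the hemispheres of the cross-polytope. -/
lemma exists_fine_hemispheres {n k : ℕ} (hnk : n < k) {δ : ℝ} (hδ : 0 < δ) :
    ∃ H : ℕ → Chain (EuclideanSpace ℝ (Fin k)),
      boundary _ (H 0) = Finsupp.single [] 1 ∧
      (∀ i, boundary _ (H (i + 1)) = H i + push (fun v => -v) (H i)) ∧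
      ∀ i ≤ n, H i ∈ chainsOf fun l => l.length = i + 1 ∧ (∀ v ∈ l, v ∈ crossSphere k) ∧
        ∀ u ∈ l, ∀ v ∈ l, dist u v < δ := by
  obtain ⟨D, hD⟩ := Metric.isBounded_iff.1 (isCompact_crossSphere k).isBounded
  have hq : |1 - 1 / ((n + 1 : ℕ) : ℝ)| < 1 := by
    have h1 : (0 : ℝ) < 1 / ((n + 1 : ℕ) : ℝ) := by positivity
    have h2 : 1 / ((n + 1 : ℕ) : ℝ) ≤ 1 := by
      rw [div_le_one (by positivity)]; push_cast; linarith [n.cast_nonneg (α := ℝ)]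
    rw [abs_lt]; constructor <;> linarith
  have hlim : Tendsto (fun m : ℕ => (1 - 1 / ((n + 1 : ℕ) : ℝ)) ^ m * D) atTop (𝓝 0) := by
    simpa using (tendsto_pow_atTop_nhds_zero_of_abs_lt_one hq).mul_const D
  obtain ⟨m, hm⟩ := (hlim.eventually (gt_mem_nhds hδ)).exists
  refine ⟨fun i => (subdiv (i + 1))^[m] (hemisphere (basisVec k) i), ?_, fun i => ?_, ?_⟩
  · have hcomm : Function.Semiconj (boundary (EuclideanSpace ℝ (Fin k))) (subdiv (0 + 1))
        (subdiv 0) := fun c => boundary_subdiv_succ 0 c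
    rw [(hcomm.iterate_right m).eq, boundary_hemisphere_zero]
    exact Function.iterate_fixed (subdiv_single 0 _) m
  · have hcomm : Function.Semiconj (boundary (EuclideanSpace ℝ (Fin k))) (subdiv (i + 1 + 1))
        (subdiv (i + 1)) := fun c => boundary_subdiv_succ (i + 1) c
    have hneg : Function.Semiconj (push fun v : EuclideanSpace ℝ (Fin k) => -v) (subdiv (i + 1))
        (subdiv (i + 1)) := fun c => (subdiv_push_neg _ c).symm
    rw [(hcomm.iterate_right m).eq, boundary_hemisphere_succ, iterate_map_add,
      ← (hneg.iterate_right m).eq]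
  · intro i hi
    have hit : ∀ m : ℕ, (subdiv (i + 1))^[m] (hemisphere (basisVec k) i) ∈ chainsOf fun l =>
        l.length = i + 1 ∧ ∃ ε : Fin k → ℝ, (∀ j, |ε j| = 1) ∧ (∀ v ∈ l, v ∈ crossFace ε) ∧
          ∀ u ∈ l, ∀ v ∈ l, dist u v ≤ (1 - 1 / ((n + 1 : ℕ) : ℝ)) ^ m * D := by
      intro m
      induction m with
      | zero =>
        refine chainsOf_mono (fun l hl => ?_) (hemisphere_mem (i := i) (k := k) (by omega))
        obtain ⟨hlen, ε, hε, hv⟩ := hl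
        refine ⟨hlen, ε, hε, fun v h => (hv v h).1, fun u hu v hv' => ?_⟩
        rw [pow_zero, one_mul]
        exact hD (crossFace_subset hε (hv u hu).1) (crossFace_subset hε (hv v hv').1)
      | succ m ih =>
        rw [Function.iterate_succ_apply']
        refine map_mem_chainsOf _ (fun l hl => ?_) ih
        obtain ⟨hlen, ε, hε, hv, hdist⟩ := hl
        rw [subdiv_single]
        refine chainsOf_mono (fun l' hl' => ?_) (subdivList_mem (N := n + 1) hlen.le
          (by omega) (convex_crossFace ε) hv hdist)
        refine ⟨hl'.1.trans hlen, ε, hε, hl'.2.1, fun u hu v hv' => ?_⟩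
        rw [pow_succ', mul_assoc]
        exact hl'.2.2 u hu v hv'
    refine chainsOf_mono (fun l hl => ?_) (hit m)
    obtain ⟨hlen, ε, hε, hv, hdist⟩ := hl
    exact ⟨hlen, fun v h => crossFace_subset hε (hv v h),
      fun u hu v hv' => (hdist u hu v hv').trans_lt hm⟩

/-- An odd map `g` without zeros on the cross-polytope boundary in `ℝᵏ` has at least `k`
components. A vertex is labelled by the index of a component of `g` of largest absolute value and
by the sign of that component. -/
lemma le_of_odd_on_crossSphere {k n : ℕ} (g : EuclideanSpace ℝ (Fin k) → Fin n → ℝ)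
    (hg : ContinuousOn g (crossSphere k))
    (hodd : ∀ v ∈ crossSphere k, g (-v) = -g v) (hne : ∀ v ∈ crossSphere k, g v ≠ 0) :
    k ≤ n := by
  by_contra! hnk
  obtain ⟨v₀, hv₀⟩ : (crossSphere k).Nonempty :=
    ⟨basisVec k 0, by
      have : ∀ j : Fin k, |basisVec k 0 j| = if j = ⟨0, by omega⟩ then 1 else 0 := by
        intro j
        by_cases hj : j = ⟨0, by omega⟩
        · subst hj; simp [basisVec]
        · have : (j : ℕ) ≠ 0 := fun h => hj (Fin.ext h)
          simp [basisVec, hj, this]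
      simp only [crossSphere, mem_ofPred_eq, this]
      simp⟩
  obtain ⟨v₁, hv₁, hmin⟩ := (isCompact_crossSphere k).exists_isMinOn ⟨v₀, hv₀⟩ hg.norm
  set m := ‖g v₁‖ with hm
  have hmpos : 0 < m := norm_pos_iff.2 (hne v₁ hv₁)
  have hgm : ∀ v ∈ crossSphere k, m ≤ ‖g v‖ := fun v hv => hmin hv
  have : Nonempty (Fin n) := by
    by_contra h
    rw [not_nonempty_iff] at h
    exact hne v₀ hv₀ (Subsingleton.elim _ _)
  choose J hJ using fun w : Fin n → ℝ => Finite.exists_max w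
  set j := fun v => J fun i => |g v i| with hj
  have hjm : ∀ v ∈ crossSphere k, m ≤ |g v (j v)| := fun v hv =>
    (hgm v hv).trans ((pi_norm_le_iff_of_nonneg (abs_nonneg _)).2 fun i => hJ (fun i => |g v i|) i)
  set lab : EuclideanSpace ℝ (Fin k) → Label n :=
    fun v => toLex (j v, decide (0 < g v (j v))) with hlab
  obtain ⟨δ, hδ, hunif⟩ := Metric.uniformContinuousOn_iff.1
    ((isCompact_crossSphere k).uniformContinuousOn_of_continuous hg) m hmpos
  obtain ⟨H, h0, hsucc, hmem⟩ := exists_fine_hemispheres hnk hδ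
  refine false_of_antipodal_labelling (fun v => -v) lab (crossSphere k) (fun v hv => ?_) H h0
    (fun i _ => hsucc i) fun i hi => chainsOf_mono (fun l hl => ⟨hl.1, hl.2.1, ?_⟩) (hmem i hi)
  · have hjv : j (-v) = j v := by
      simp only [hj, hodd v hv, Pi.neg_apply, abs_neg]
    have hpos : g v (j v) ≠ 0 := abs_pos.1 (hmpos.trans_le (hjm v hv))
    have : decide (0 < g (-v) (j v)) = !decide (0 < g v (j v)) := by
      rw [hodd v hv, Pi.neg_apply, ← decide_not, decide_eq_decide, neg_pos, not_lt]
      exact ⟨le_of_lt, fun h => lt_of_le_of_ne h hpos⟩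
    simp only [hlab, flipLabel, ofLex_toLex, hjv, this]
  · intro x hx y hy hxy
    obtain ⟨u, hu, rfl⟩ := List.mem_map.1 hx
    obtain ⟨v, hv, rfl⟩ := List.mem_map.1 hy
    have huv : j u = j v := hxy
    -- Opposite signs of a component of absolute value at least `m` contradict the small distance.
    have hdist : |g u (j v) - g v (j v)| < m := by
      rw [← Real.dist_eq]
      exact (dist_le_pi_dist _ _ _).trans_lt
        (hunif u (hl.2.1 u hu) v (hl.2.1 v hv) (hl.2.2 u hu v hv))
    have h1 := hjm u (hl.2.1 u hu)
    have h2 := hjm v (hl.2.1 v hv)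
    rw [huv] at h1
    have : (0 < g u (j v)) ↔ (0 < g v (j v)) := by
      rw [abs_lt] at hdist
      constructor
      · intro h
        rw [abs_of_pos h] at h1
        linarith
      · intro h
        rw [abs_of_pos h] at h2
        linarith
    simp only [hlab, huv, this]

/-- The Borsuk–Ulam theorem. -/
theorem le_of_odd_on_sphere {k n : ℕ}
    (f : Metric.sphere (0 : EuclideanSpace ℝ (Fin k)) 1 → EuclideanSpace ℝ (Fin n))
    (hf : Continuous f) (hodd : ∀ x, f (-x) = -f x) (hne : ∀ x, f x ≠ 0) : k ≤ n := by
  classical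
  have hnorm : ∀ v : crossSphere k, ‖(v : EuclideanSpace ℝ (Fin k))‖ ≠ 0 := fun v =>
    norm_ne_zero_iff.2 (ne_zero_of_mem_crossSphere v.2)
  set r : crossSphere k → Metric.sphere (0 : EuclideanSpace ℝ (Fin k)) 1 := fun v =>
    ⟨‖(v : EuclideanSpace ℝ (Fin k))‖⁻¹ • (v : EuclideanSpace ℝ (Fin k)), by
      rw [mem_sphere_zero_iff_norm, norm_smul, norm_inv, norm_norm, inv_mul_cancel₀ (hnorm v)]⟩
    with hr
  have hrc : Continuous r := by
    refine Continuous.subtype_mk (Continuous.smul (Continuous.inv₀ ?_ hnorm) ?_) _ <;> fun_prop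
  have hneg : ∀ v ∈ crossSphere k, -v ∈ crossSphere k := fun v hv => by
    simpa [crossSphere] using hv
  obtain ⟨g, hgr⟩ : ∃ g : EuclideanSpace ℝ (Fin k) → Fin n → ℝ,
      ∀ v (hv : v ∈ crossSphere k), g v = WithLp.ofLp (f (r ⟨v, hv⟩)) :=
    ⟨fun v => if h : v ∈ crossSphere k then WithLp.ofLp (f (r ⟨v, h⟩)) else 0,
      fun v hv => dif_pos hv⟩
  refine le_of_odd_on_crossSphere g ?_ ?_ ?_
  · rw [continuousOn_iff_continuous_domRestrict]
    have : Continuous fun v : crossSphere k => WithLp.ofLp (f (r v)) :=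
      (PiLp.continuous_ofLp 2 _).comp (hf.comp hrc)
    exact this.congr fun v => (hgr v v.2).symm
  · intro v hv
    rw [hgr v hv, hgr _ (hneg v hv)]
    have : r ⟨-v, hneg v hv⟩ = -r ⟨v, hv⟩ := Subtype.ext (by simp [hr])
    rw [this, hodd]
    rfl
  · intro v hv h0
    rw [hgr v hv] at h0
    exact hne _ ((WithLp.ofLp_eq_zero 2).1 h0)

end BorsukUlam

namespace WeakSlopeTheory

/-! ### The weak slope and equivariant deformations of compact sets -/

section Slope

variable {M : Type*} [MetricSpace M] {f : M → ℝ}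

lemma le_weakSlope {u : M} {σ : ℝ≥0} {δ : ℝ} (hδ : 0 < δ) {η : M × ℝ → M}
    (hη : ContinuousOn η (Metric.ball u δ ×ˢ Icc 0 δ))
    (h : ∀ v ∈ Metric.ball u δ, ∀ t ∈ Icc (0 : ℝ) δ,
      dist (η (v, t)) v ≤ t ∧ f (η (v, t)) ≤ f v - σ * t) :
    (σ : ℝ≥0∞) ≤ weakSlope f u :=
  le_iSup₂ (f := fun (σ : ℝ≥0) (_ : ∃ δ : ℝ, 0 < δ ∧ ∃ η : M × ℝ → M,
      ContinuousOn η (Metric.ball u δ ×ˢ Icc 0 δ) ∧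
      ∀ v ∈ Metric.ball u δ, ∀ t ∈ Icc (0 : ℝ) δ,
        dist (η (v, t)) v ≤ t ∧ f (η (v, t)) ≤ f v - σ * t) => (σ : ℝ≥0∞))
    σ ⟨δ, hδ, η, hη, h⟩

lemma exists_flow_of_lt_weakSlope {u : M} {a : ℝ≥0∞} (h : a < weakSlope f u) :
    ∃ σ : ℝ≥0, a < σ ∧ ∃ δ : ℝ, 0 < δ ∧ ∃ η : M × ℝ → M,
      ContinuousOn η (Metric.ball u δ ×ˢ Icc 0 δ) ∧
      ∀ v ∈ Metric.ball u δ, ∀ t ∈ Icc (0 : ℝ) δ,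
        dist (η (v, t)) v ≤ t ∧ f (η (v, t)) ≤ f v - σ * t := by
  obtain ⟨σ, hσ⟩ := lt_iSup_iff.1 h
  obtain ⟨hw, hσ⟩ := lt_iSup_iff.1 hσ
  exact ⟨σ, hσ, hw⟩

lemma lowerSemicontinuous_weakSlope (f : M → ℝ) : LowerSemicontinuous (weakSlope f) := by
  intro u a ha
  obtain ⟨σ, hσ, δ, hδ, η, hη, h⟩ := exists_flow_of_lt_weakSlope ha
  filter_upwards [Metric.ball_mem_nhds u (half_pos hδ)] with v hv
  have hball : Metric.ball v (δ / 2) ⊆ Metric.ball u δ := by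
    refine Metric.ball_subset_ball' ?_
    have := Metric.mem_ball.1 hv
    linarith
  have hIcc : Icc 0 (δ / 2) ⊆ Icc 0 δ := Icc_subset_Icc_right (by linarith)
  exact hσ.trans_le (le_weakSlope (half_pos hδ) (hη.mono (prod_mono hball hIcc))
    fun w hw t ht => h w (hball hw) t (hIcc ht))

lemma weakSlope_involution {ι : M → M} (hι : Isometry ι) (hinv : ∀ v, ι (ι v) = v)
    (hf : ∀ v, f (ι v) = f v) (u : M) : weakSlope f (ι u) = weakSlope f u := by
  have key : ∀ u, weakSlope f (ι u) ≤ weakSlope f u := by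
    refine fun u => iSup₂_le fun σ hσ => ?_
    obtain ⟨δ, hδ, η, hη, h⟩ := hσ
    have hball : ∀ v ∈ Metric.ball u δ, ι v ∈ Metric.ball (ι u) δ := fun v hv => by
      rwa [Metric.mem_ball, hι.dist_eq]
    refine le_weakSlope hδ (η := fun q => ι (η (ι q.1, q.2))) ?_ fun v hv t ht => ?_
    · refine hι.continuous.comp_continuousOn (hη.comp (Continuous.continuousOn ?_) fun q hq =>
        ⟨hball _ hq.1, hq.2⟩)
      exact (hι.continuous.comp continuous_fst).prodMk continuous_snd
    · obtain ⟨h1, h2⟩ := h (ι v) (hball v hv) t ht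
      refine ⟨?_, ?_⟩
      · rwa [← hι.dist_eq, hinv]
      · rwa [hf, ← hf v]
  refine le_antisymm (key u) ?_
  have := key (ι u)
  rwa [hinv] at this

variable {ι : M → M}

/-- Near a point that is not fixed by the involution `ι`, the local deformations in the definition
of the weak slope can be chosen equivariant. -/
lemma exists_equivariant_flow (hι : Isometry ι) (hinv : ∀ v, ι (ι v) = v)
    (hf : ∀ v, f (ι v) = f v) {p : M} (hp : p ≠ ι p) {σ : ℝ≥0}
    (hσ : (σ : ℝ≥0∞) < weakSlope f p) :
    ∃ r : ℝ, 0 < r ∧ ∃ η : M × ℝ → M,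
      ContinuousOn η ((Metric.ball p r ∪ Metric.ball (ι p) r) ×ˢ Icc 0 r) ∧
      ∀ v ∈ Metric.ball p r ∪ Metric.ball (ι p) r, ∀ t ∈ Icc (0 : ℝ) r,
        dist (η (v, t)) v ≤ t ∧ f (η (v, t)) ≤ f v - σ * t ∧ η (ι v, t) = ι (η (v, t)) := by
  classical
  obtain ⟨σ', hσ', δ, hδ, η, hη, h⟩ := exists_flow_of_lt_weakSlope hσ
  have hσσ : (σ : ℝ) ≤ σ' := by
    have : σ < σ' := by exact_mod_cast hσ'
    exact_mod_cast this.le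
  have hd : 0 < dist p (ι p) := dist_pos.2 hp
  set r := min δ (dist p (ι p) / 2) with hr
  have hr0 : 0 < r := lt_min hδ (by linarith)
  have hdisj : Disjoint (Metric.ball p r) (Metric.ball (ι p) r) :=
    Metric.ball_disjoint_ball (by linarith [min_le_right δ (dist p (ι p) / 2)])
  have hball : Metric.ball p r ⊆ Metric.ball p δ := Metric.ball_subset_ball (min_le_left _ _)
  have hIcc : Icc 0 r ⊆ Icc 0 δ := Icc_subset_Icc_right (min_le_left _ _)
  have hιball : ∀ v ∈ Metric.ball p r, ι v ∈ Metric.ball (ι p) r := fun v hv => by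
    rwa [Metric.mem_ball, hι.dist_eq]
  have hιball' : ∀ v ∈ Metric.ball (ι p) r, ι v ∈ Metric.ball p r := fun v hv => by
    rw [Metric.mem_ball, ← hι.dist_eq, hinv]; exact hv
  set ζ : M × ℝ → M := fun q => if q.1 ∈ Metric.ball p r then η q else ι (η (ι q.1, q.2)) with hζ
  have hζ1 : ∀ v ∈ Metric.ball p r, ∀ t, ζ (v, t) = η (v, t) := fun v hv t => if_pos hv
  have hζ2 : ∀ v ∈ Metric.ball (ι p) r, ∀ t, ζ (v, t) = ι (η (ι v, t)) := fun v hv t =>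
    if_neg fun hv' => hdisj.le_bot ⟨hv', hv⟩
  have hc1 : ContinuousOn ζ (Metric.ball p r ×ˢ Icc 0 r) :=
    (hη.mono (prod_mono hball hIcc)).congr fun q hq => hζ1 q.1 hq.1 q.2
  have hc2 : ContinuousOn ζ (Metric.ball (ι p) r ×ˢ Icc 0 r) := by
    refine ContinuousOn.congr (f := fun q : M × ℝ => ι (η (ι q.1, q.2))) ?_
      fun q hq => hζ2 q.1 hq.1 q.2
    refine hι.continuous.comp_continuousOn (hη.comp (Continuous.continuousOn ?_) fun q hq =>
      ⟨hball (hιball' _ hq.1), hIcc hq.2⟩)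
    exact (hι.continuous.comp continuous_fst).prodMk continuous_snd
  have hlocal : ∀ (c : M) (q : M × ℝ), q.1 ∈ Metric.ball c r →
      Metric.ball c r ×ˢ Icc 0 r ∈
        𝓝[(Metric.ball p r ∪ Metric.ball (ι p) r) ×ˢ Icc 0 r] q := by
    intro c q hq
    have : (Prod.fst ⁻¹' Metric.ball c r : Set (M × ℝ)) ∈ 𝓝 q :=
      continuous_fst.continuousAt.preimage_mem_nhds (Metric.isOpen_ball.mem_nhds hq)
    filter_upwards [mem_nhdsWithin_of_mem_nhds this, self_mem_nhdsWithin] with w hw1 hw2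
    exact ⟨hw1, hw2.2⟩
  refine ⟨r, hr0, ζ, ?_, ?_⟩
  · rintro q ⟨hq1 | hq1, hq2⟩
    · exact (hc1 q ⟨hq1, hq2⟩).mono_of_mem_nhdsWithin (hlocal p q hq1)
    · exact (hc2 q ⟨hq1, hq2⟩).mono_of_mem_nhdsWithin (hlocal (ι p) q hq1)
  · rintro v (hv | hv) t ht
    · obtain ⟨h1, h2⟩ := h v (hball hv) t (hIcc ht)
      rw [hζ1 v hv, hζ2 _ (hιball v hv), hinv]
      refine ⟨h1, h2.trans ?_, rfl⟩
      have := mul_le_mul_of_nonneg_right hσσ ht.1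
      linarith
    · obtain ⟨h1, h2⟩ := h (ι v) (hball (hιball' v hv)) t (hIcc ht)
      rw [hζ2 v hv, hζ1 _ (hιball' v hv), hinv]
      refine ⟨by rwa [← hι.dist_eq, hinv], ?_, rfl⟩
      rw [hf, ← hf v]
      refine h2.trans ?_
      have := mul_le_mul_of_nonneg_right hσσ ht.1
      linarith

variable {S : Type*} [TopologicalSpace S] {ν : S → S} {h : S → M}

/-- Local equivariant deformations `η i`, run one after the other for the times `t * θ i x`, give a
continuous equivariant deformation of `h`: the total time is `t * ∑ i, θ i x`, so that each point
stays in the domains of the deformations that move it. -/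
lemma exists_composed_flow (hh : Continuous h) (hhν : ∀ x, h (ν x) = ι (h x)) {σ : ℝ≥0}
    {I : Type*} (s : Finset I) (p : I → M) (r : I → ℝ) (η : I → M × ℝ → M) (hr : ∀ i, 0 < r i)
    (hη : ∀ i, ContinuousOn (η i)
      ((Metric.ball (p i) (r i) ∪ Metric.ball (ι (p i)) (r i)) ×ˢ Icc 0 (r i)))
    (hflow : ∀ i, ∀ v ∈ Metric.ball (p i) (r i) ∪ Metric.ball (ι (p i)) (r i),
      ∀ t ∈ Icc (0 : ℝ) (r i), dist (η i (v, t)) v ≤ t ∧ f (η i (v, t)) ≤ f v - σ * t ∧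
        η i (ι v, t) = ι (η i (v, t)))
    (θ : I → S → ℝ) (hθ : ∀ i, Continuous (θ i)) (hθ0 : ∀ i x, 0 ≤ θ i x)
    (hθν : ∀ i x, θ i (ν x) = θ i x)
    (hsupp : ∀ i x, θ i x ≠ 0 → dist (h x) (p i) ≤ r i / 2 ∨ dist (h x) (ι (p i)) ≤ r i / 2)
    (hsum : ∀ x, ∑ i ∈ s, θ i x ≤ 1) {t : ℝ} (ht : 0 ≤ t) (htr : ∀ i ∈ s, 4 * t ≤ r i) :
    ∃ H : S → M, Continuous H ∧ (∀ x, H (ν x) = ι (H x)) ∧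
      ∀ x, dist (H x) (h x) ≤ t * ∑ i ∈ s, θ i x ∧
        f (H x) ≤ f (h x) - σ * (t * ∑ i ∈ s, θ i x) := by
  classical
  induction s using Finset.induction_on with
  | empty => exact ⟨h, hh, hhν, fun x => by simp⟩
  | insert i s hi ih =>
    obtain ⟨H, hH, hHν, hHx⟩ := ih
      (fun x => (Finset.sum_le_sum_of_subset_of_nonneg (Finset.subset_insert i s)
        fun j _ _ => hθ0 j x).trans (hsum x))
      fun j hj => htr j (Finset.mem_insert_of_mem hj)
    have htri : 4 * t ≤ r i := htr i (Finset.mem_insert_self i s)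
    have hri := hr i
    have hθ1 : ∀ x, θ i x ≤ 1 := fun x =>
      (Finset.single_le_sum (f := fun j => θ j x) (fun j _ => hθ0 j x)
        (Finset.mem_insert_self i s)).trans (hsum x)
    have hHt : ∀ x, dist (H x) (h x) ≤ t := fun x => by
      refine (hHx x).1.trans (mul_le_of_le_one_right ht ?_)
      exact (Finset.sum_le_sum_of_subset_of_nonneg (Finset.subset_insert i s)
        fun j _ _ => hθ0 j x).trans (hsum x)
    -- `θ i` vanishes near each point outside `W`, and `H` maps `W` into the domain of `η i`, as it
    -- differs from `h` by at most `t ≤ r i / 4`.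
    set W : Set S := {x | dist (h x) (p i) < 3 * r i / 4 ∨ dist (h x) (ι (p i)) < 3 * r i / 4}
      with hW
    have hWopen : IsOpen W :=
      (isOpen_lt (hh.dist continuous_const) continuous_const).union
        (isOpen_lt (hh.dist continuous_const) continuous_const)
    have hθW : ∀ x, θ i x ≠ 0 → x ∈ W := fun x hx =>
      (hsupp i x hx).imp (fun h => by linarith) (fun h => by linarith)
    have hHW : ∀ x ∈ W, H x ∈ Metric.ball (p i) (r i) ∪ Metric.ball (ι (p i)) (r i) := by
      rintro x (hx | hx)
      · refine Or.inl (Metric.mem_ball.2 ((dist_triangle _ (h x) _).trans_lt ?_))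
        linarith [hHt x]
      · refine Or.inr (Metric.mem_ball.2 ((dist_triangle _ (h x) _).trans_lt ?_))
        linarith [hHt x]
    have htime : ∀ x, t * θ i x ∈ Icc 0 (r i) := fun x =>
      ⟨mul_nonneg ht (hθ0 i x), (mul_le_of_le_one_right ht (hθ1 x)).trans (by linarith)⟩
    set G : S → M := fun x => if θ i x = 0 then H x else η i (H x, t * θ i x) with hG
    have hGW : ∀ x ∈ W, G x = η i (H x, t * θ i x) := by
      intro x hx
      by_cases h0 : θ i x = 0
      · have h1 := (hflow i _ (hHW x hx) (t * θ i x) (htime x)).1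
        rw [h0, mul_zero] at h1
        simp only [hG, h0, if_true, mul_zero]
        exact (dist_le_zero.1 h1).symm
      · simp only [hG, h0, if_false]
    refine ⟨G, ?_, fun x => ?_, fun x => ?_⟩
    · rw [continuous_iff_continuousAt]
      intro x
      by_cases hx : x ∈ W
      · have hWn : W ∈ 𝓝 x := hWopen.mem_nhds hx
        have hcont : ContinuousOn (fun x => η i (H x, t * θ i x)) W :=
          (hη i).comp (Continuous.continuousOn (hH.prodMk (continuous_const.mul (hθ i))))
            fun y hy => ⟨hHW y hy, htime y⟩
        exact (hcont.continuousAt hWn).congr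
          (eventually_of_mem hWn fun y hy => (hGW y hy).symm)
      · have hV : {y | r i / 2 < dist (h y) (p i) ∧ r i / 2 < dist (h y) (ι (p i))} ∈ 𝓝 x := by
          refine (IsOpen.inter (isOpen_lt continuous_const (hh.dist continuous_const))
            (isOpen_lt continuous_const (hh.dist continuous_const))).mem_nhds ?_
          simp only [hW, mem_ofPred_eq, not_or, not_lt] at hx
          exact ⟨lt_of_lt_of_le (by linarith) hx.1, lt_of_lt_of_le (by linarith) hx.2⟩
        refine hH.continuousAt.congr (eventually_of_mem hV fun y hy => ?_)
        have h0 : θ i y = 0 := by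
          by_contra h0
          rcases hsupp i y h0 with h1 | h1
          · exact absurd h1 (not_le.2 hy.1)
          · exact absurd h1 (not_le.2 hy.2)
        simp only [hG, h0, if_true]
    · by_cases h0 : θ i x = 0
      · simp only [hG, hθν, h0, if_true, hHν]
      · simp only [hG, hθν, h0, if_false, hHν]
        exact (hflow i _ (hHW x (hθW x h0)) _ (htime x)).2.2
    · rw [Finset.sum_insert hi, mul_add]
      obtain ⟨h1, h2⟩ := hHx x
      by_cases h0 : θ i x = 0
      · simp only [hG, h0, if_true, mul_zero, zero_add]
        exact ⟨h1, h2⟩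
      · obtain ⟨h3, h4, -⟩ := hflow i _ (hHW x (hθW x h0)) _ (htime x)
        simp only [hG, h0, if_false]
        refine ⟨(dist_triangle _ (H x) _).trans (add_le_add h3 h1), ?_⟩
        rw [mul_add]
        linarith

/-- A compact family of points of weak slope larger than `σ` can be deformed equivariantly by a
distance at most `t`, for some `t > 0`, so that `f` decreases by at least `σ * t`. -/
lemma exists_equivariant_deformation [CompactSpace S] (hι : Isometry ι)
    (hinv : ∀ v, ι (ι v) = v) (hf : ∀ v, f (ι v) = f v) (hh : Continuous h)
    (hhν : ∀ x, h (ν x) = ι (h x)) (hfree : ∀ x, h x ≠ ι (h x)) {σ : ℝ≥0}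
    (hσ : ∀ x, (σ : ℝ≥0∞) < weakSlope f (h x)) :
    ∃ t : ℝ, 0 < t ∧ ∃ H : S → M, Continuous H ∧ (∀ x, H (ν x) = ι (H x)) ∧
      ∀ x, dist (H x) (h x) ≤ t ∧ f (H x) ≤ f (h x) - σ * t := by
  choose r hr η hη hflow using fun x => exists_equivariant_flow hι hinv hf (hfree x) (hσ x)
  obtain ⟨s, hs⟩ := CompactSpace.elim_nhds_subcover
    (fun x => h ⁻¹' Metric.ball (h x) (r x / 2)) fun x =>
      hh.continuousAt.preimage_mem_nhds (Metric.ball_mem_nhds _ (half_pos (hr x)))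
  set b : S → S → ℝ := fun i x =>
    max 0 (r i / 2 - dist (h x) (h i)) + max 0 (r i / 2 - dist (h x) (ι (h i))) with hb
  have hb0 : ∀ i x, 0 ≤ b i x := fun i x => add_nonneg (le_max_left _ _) (le_max_left _ _)
  have hbc : ∀ i, Continuous (b i) := fun i =>
    (continuous_const.max (continuous_const.sub (hh.dist continuous_const))).add
      (continuous_const.max (continuous_const.sub (hh.dist continuous_const)))
  have hbν : ∀ i x, b i (ν x) = b i x := fun i x => by
    have h1 : dist (ι (h x)) (h i) = dist (h x) (ι (h i)) := by rw [← hι.dist_eq, hinv]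
    simp only [hb, hhν, hι.dist_eq, h1]
    exact add_comm _ _
  have hBpos : ∀ x, 0 < ∑ i ∈ s, b i x := fun x => by
    have hx : x ∈ ⋃ i ∈ s, h ⁻¹' Metric.ball (h i) (r i / 2) := by rw [hs]; trivial
    obtain ⟨i, hi, hxi⟩ := mem_iUnion₂.1 hx
    refine Finset.sum_pos' (fun i _ => hb0 i x) ⟨i, hi, ?_⟩
    have : dist (h x) (h i) < r i / 2 := hxi
    exact add_pos_of_pos_of_nonneg (lt_max_of_lt_right (by linarith)) (le_max_left _ _)
  have hsmall : ∀ᶠ t : ℝ in 𝓝[>] 0, ∀ i ∈ s, 4 * t ≤ r i := by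
    refine (Finset.eventually_all s).2 fun i _ => ?_
    have : Iio (r i / 4) ∈ 𝓝[>] (0 : ℝ) :=
      mem_nhdsWithin_of_mem_nhds (Iio_mem_nhds (by linarith [hr i]))
    filter_upwards [this] with t ht
    have := mem_Iio.1 ht
    linarith
  obtain ⟨t, htr, ht⟩ := (hsmall.and self_mem_nhdsWithin).exists
  have ht : 0 < t := ht
  have hone : ∀ x, ∑ i ∈ s, b i x / ∑ j ∈ s, b j x = 1 := fun x => by
    rw [← Finset.sum_div, div_self (hBpos x).ne']
  obtain ⟨H, hH, hHν, hHx⟩ := exists_composed_flow hh hhν s h r η hr hη hflow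
    (fun i x => b i x / ∑ j ∈ s, b j x)
    (fun i => (hbc i).div (continuous_finsetSum _ fun j _ => hbc j) fun x => (hBpos x).ne')
    (fun i x => div_nonneg (hb0 i x) (hBpos x).le)
    (fun i x => by simp only [hbν])
    (fun i x hx => by
      by_contra! hcon
      refine hx ?_
      have h1 : max 0 (r i / 2 - dist (h x) (h i)) = 0 := max_eq_left (by linarith [hcon.1])
      have h2 : max 0 (r i / 2 - dist (h x) (ι (h i))) = 0 := max_eq_left (by linarith [hcon.2])
      simp only [hb, h1, h2, add_zero, zero_div])
    (fun x => (hone x).le) ht.le htr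
  refine ⟨t, ht, H, hH, hHν, fun x => ?_⟩
  have := hHx x
  rwa [hone, mul_one] at this

end Slope

/-! ### Ekeland's variational principle -/

/-- Ekeland's variational principle on a closed set, for a continuous function. -/
lemma exists_ekeland_point {Y : Type*} [MetricSpace Y] [CompleteSpace Y] {T : Y → ℝ}
    (hT : Continuous T) {A : Set Y} (hA : IsClosed A) (hne : A.Nonempty) {m : ℝ}
    (hm : ∀ y ∈ A, m ≤ T y) {σ : ℝ} (hσ : 0 < σ) :
    ∃ y ∈ A, ∀ z ∈ A, σ * dist y z ≤ T y - T z → z = y := by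
  set D : Y → Set Y := fun y => {z | z ∈ A ∧ σ * dist y z ≤ T y - T z} with hD
  have hself : ∀ y ∈ A, y ∈ D y := fun y hy => ⟨hy, by simp⟩
  have htrans : ∀ y z, z ∈ D y → D z ⊆ D y := fun y z hz w hw => by
    refine ⟨hw.1, ?_⟩
    have := mul_le_mul_of_nonneg_left (dist_triangle y z w) hσ.le
    linarith [hz.2, hw.2]
  have hclosed : ∀ y, IsClosed (D y) := fun y =>
    hA.inter (isClosed_le (continuous_const.mul (continuous_const.dist continuous_id))
      (continuous_const.sub hT))
  have hstep : ∀ (n : ℕ) (y : A), ∃ z : A, (z : Y) ∈ D y ∧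
      ∀ w ∈ D y, T z ≤ T w + 1 / ((n : ℝ) + 1) := by
    intro n y
    have hbdd : BddBelow (T '' D y) := ⟨m, by rintro _ ⟨w, hw, rfl⟩; exact hm w hw.1⟩
    obtain ⟨_, ⟨z, hz, rfl⟩, hlt⟩ := exists_lt_of_csInf_lt
      (Set.Nonempty.image T (s := D y) ⟨y, hself y y.2⟩)
      (lt_add_of_pos_right (sInf (T '' D y)) (Nat.one_div_pos_of_nat (α := ℝ) (n := n)))
    refine ⟨⟨z, hz.1⟩, hz, fun w hw => hlt.le.trans ?_⟩
    have := csInf_le hbdd (mem_image_of_mem T hw)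
    linarith
  choose nxt hnxt hnxt' using hstep
  obtain ⟨y₀, hy₀⟩ := hne
  set y : ℕ → A := fun n => Nat.rec ⟨y₀, hy₀⟩ (fun n y => nxt n y) n with hy
  have hanti : ∀ n m, n ≤ m → D (y m) ⊆ D (y n) := by
    intro n m hnm
    induction m, hnm using Nat.le_induction with
    | base => exact subset_rfl
    | succ m _ ih => exact (htrans _ _ (hnxt m (y m))).trans ih
  have hsmall : ∀ n, ∀ z ∈ D (y (n + 1)), dist (y (n + 1) : Y) z ≤ 1 / ((n : ℝ) + 1) / σ := by
    intro n z hz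
    have h1 : T (y (n + 1)) ≤ T z + 1 / ((n : ℝ) + 1) :=
      hnxt' n (y n) z (hanti n (n + 1) n.le_succ hz)
    rw [le_div_iff₀ hσ]
    linarith [hz.2, mul_comm σ (dist (y (n + 1) : Y) z)]
  have hmem : ∀ n m, n ≤ m → (y m : Y) ∈ D (y n) := fun n m hnm =>
    hanti n m hnm (hself _ (y m).2)
  have hlim0 : Tendsto (fun n : ℕ => 1 / ((n : ℝ) + 1) / σ) atTop (𝓝 0) := by
    simpa using (tendsto_one_div_add_atTop_nhds_zero_nat (𝕜 := ℝ)).div_const σ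
  have hcauchy : CauchySeq fun n => (y (n + 1) : Y) := by
    refine cauchySeq_of_le_tendsto_0 (fun n : ℕ => 1 / ((n : ℝ) + 1) / σ + 1 / ((n : ℝ) + 1) / σ)
      (fun n m N hn hm => ?_) (by simpa using hlim0.add hlim0)
    refine (dist_triangle_left _ _ (y (N + 1) : Y)).trans (add_le_add ?_ ?_)
    · exact hsmall N _ (hmem (N + 1) (n + 1) (by omega))
    · exact hsmall N _ (hmem (N + 1) (m + 1) (by omega))
  obtain ⟨z, hz⟩ := cauchySeq_tendsto_of_complete hcauchy
  have hzD : ∀ n, z ∈ D (y n) := fun n =>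
    (hclosed _).mem_of_tendsto hz (eventually_atTop.2 ⟨n, fun m hm => hmem n (m + 1) (by omega)⟩)
  refine ⟨z, (hzD 0).1, fun w hwA hw => ?_⟩
  have hw' : Tendsto (fun n => (y (n + 1) : Y)) atTop (𝓝 w) := by
    rw [tendsto_iff_dist_tendsto_zero]
    exact squeeze_zero (fun _ => dist_nonneg)
      (fun n => hsmall n w (htrans _ _ (hzD (n + 1)) ⟨hwA, hw⟩)) hlim0
  exact tendsto_nhds_unique hw' hz

/-! ### The epigraph of an even function -/

section Epigraph

variable {X : Type*} [NormedAddCommGroup X] {F : X → EReal}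

/-- The point `(u, T)` of the epigraph. -/
def levelPoint (F : X → EReal) (u : X) (T : ℝ) (h : F u ≤ (T : EReal)) : epigraph F :=
  ⟨WithLp.toLp 2 (u, T), h⟩

lemma levelPoint_eq_graphPoint {u : X} {T : ℝ} (h : F u = (T : EReal)) (hu : F u ≠ ⊤) :
    levelPoint F u T h.le = graphPoint F u hu := by
  refine Subtype.ext ?_
  simp only [levelPoint, graphPoint, h, EReal.toReal_coe]

/-- The reflection `(u, t) ↦ (-u, t)` of the epigraph of an even function. -/
def epiNeg (heven : ∀ u, F (-u) = F u) (p : epigraph F) : epigraph F :=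
  ⟨WithLp.toLp 2 (-p.1.fst, p.1.snd), (heven p.1.fst).le.trans p.2⟩

lemma isometry_epiNeg (heven : ∀ u, F (-u) = F u) : Isometry (epiNeg heven) := by
  refine Isometry.of_dist_eq fun p q => ?_
  rw [Subtype.dist_eq, Subtype.dist_eq, WithLp.prod_dist_eq_of_L2, WithLp.prod_dist_eq_of_L2]
  simp only [epiNeg, WithLp.toLp_fst, WithLp.toLp_snd, dist_neg_neg]

lemma epiNeg_epiNeg (heven : ∀ u, F (-u) = F u) (p : epigraph F) :
    epiNeg heven (epiNeg heven p) = p := by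
  refine Subtype.ext ?_
  simp only [epiNeg, WithLp.toLp_fst, WithLp.toLp_snd, neg_neg]
  rfl

lemma lscWeakSlope_neg (heven : ∀ u, F (-u) = F u) (u : X) :
    lscWeakSlope F (-u) = lscWeakSlope F u := by
  by_cases h : F u ≠ ⊤
  · have h' : F (-u) ≠ ⊤ := by rwa [heven]
    have hg : graphPoint F (-u) h' = epiNeg heven (graphPoint F u h) := by
      refine Subtype.ext ?_
      simp only [graphPoint, epiNeg, heven, WithLp.toLp_fst, WithLp.toLp_snd]
    have hs : weakSlope (epiHeight F) (graphPoint F (-u) h') =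
        weakSlope (epiHeight F) (graphPoint F u h) := by
      rw [hg]
      exact weakSlope_involution (isometry_epiNeg heven) (epiNeg_epiNeg heven) (fun _ => rfl) _
    rw [lscWeakSlope, dif_pos h', lscWeakSlope, dif_pos h, hs]
  · have h' : ¬F (-u) ≠ ⊤ := by rwa [heven]
    rw [lscWeakSlope, dif_neg h', lscWeakSlope, dif_neg h]

lemma lscWeakSlope_le {u : X} (h : F u ≠ ⊤)
    (hs : weakSlope (epiHeight F) (graphPoint F u h) ≤ 1 / 2) :
    lscWeakSlope F u ≤ 2 * weakSlope (epiHeight F) (graphPoint F u h) := by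
  set s := weakSlope (epiHeight F) (graphPoint F u h) with hs'
  have hhalf : (1 / 2 : ℝ≥0∞) < 1 := by
    rw [one_div]; exact ENNReal.one_half_lt_one
  have hlt : s < 1 := hs.trans_lt hhalf
  have htop : s ≠ ⊤ := (hlt.trans ENNReal.one_lt_top).ne
  have hs2 : s.toReal ≤ 1 / 2 := by
    have := ENNReal.toReal_mono (hhalf.trans ENNReal.one_lt_top).ne hs
    simpa using this
  have hsqrt : 1 / 2 ≤ √(1 - s.toReal ^ 2) := by
    refine Real.le_sqrt_of_sq_le ?_
    nlinarith [ENNReal.toReal_nonneg (a := s)]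
  rw [lscWeakSlope, dif_pos h, if_pos hlt]
  calc ENNReal.ofReal (s.toReal / √(1 - s.toReal ^ 2)) ≤ ENNReal.ofReal (2 * s.toReal) := by
        refine ENNReal.ofReal_le_ofReal ?_
        rw [div_le_iff₀ (by linarith)]
        nlinarith [ENNReal.toReal_nonneg (a := s)]
    _ = 2 * s := by
        rw [ENNReal.ofReal_mul zero_le_two, ENNReal.ofReal_toReal htop]
        norm_num

lemma isCriticalPoint_of_weakSlope_eq_zero {u : X} {c : ℝ} (h : F u = (c : EReal))
    (hs : weakSlope (epiHeight F) (levelPoint F u c h.le) = 0) : IsCriticalPoint F u := by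
  have hu : F u ≠ ⊤ := by rw [h]; exact EReal.coe_ne_top c
  rw [levelPoint_eq_graphPoint h hu] at hs
  have := lscWeakSlope_le hu (by rw [hs]; exact zero_le)
  rw [hs, mul_zero] at this
  exact le_antisymm this zero_le

lemma weakSlope_pos_of_lt (hepi : EpiCondition F) {u : X} {c : ℝ} (h : F u < (c : EReal)) :
    0 < weakSlope (epiHeight F) (levelPoint F u c h.le) :=
  (hepi (|c| + 1) (by positivity)).trans_le
    (iInf₂_le (levelPoint F u c h.le) ⟨h, lt_add_one |c|⟩)

/-- An odd family on which `F ≤ T`, and along which the level points `(g x, T)` of the epigraph have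
weak slope larger than `σ`, can be pushed into a lower sublevel set. -/
lemma exists_odd_deformation (heven : ∀ u, F (-u) = F u) (hzero : F 0 = ⊤)
    [NormedSpace ℝ X] {S : Type*} [TopologicalSpace S] [CompactSpace S] {ν : S → S} {g : S → X}
    (hg : Continuous g) (hgν : ∀ x, g (ν x) = -g x) {T : ℝ} (hT : ∀ x, F (g x) ≤ (T : EReal))
    {σ : ℝ≥0}
    (hσ : ∀ x, (σ : ℝ≥0∞) < weakSlope (epiHeight F) (levelPoint F (g x) T (hT x))) :
    ∃ t : ℝ, 0 < t ∧ ∃ g' : S → X, Continuous g' ∧ (∀ x, g' (ν x) = -g' x) ∧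
      ∀ x, dist (g' x) (g x) ≤ t ∧ F (g' x) ≤ ((T - σ * t : ℝ) : EReal) := by
  obtain ⟨t, ht, H, hH, hHν, hHx⟩ := exists_equivariant_deformation (f := epiHeight F)
    (ι := epiNeg heven) (ν := ν) (h := fun x => levelPoint F (g x) T (hT x))
    (isometry_epiNeg heven) (epiNeg_epiNeg heven) (fun _ => rfl)
    (Continuous.subtype_mk
      ((WithLp.prod_continuous_toLp 2 X ℝ).comp (hg.prodMk continuous_const)) _)
    (fun x => Subtype.ext (by simp only [levelPoint, epiNeg, hgν, WithLp.toLp_fst, WithLp.toLp_snd]))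
    (fun x hx => by
      have h1 : g x = -g x := congrArg (fun p : epigraph F => p.1.fst) hx
      have h2 : g x = 0 := by
        have h3 : (2 : ℝ) • g x = 0 := by
          rw [two_smul]
          nth_rewrite 1 [h1]
          exact neg_add_cancel _
        simpa using h3
      have := hT x
      rw [h2, hzero] at this
      exact EReal.coe_ne_top T (top_le_iff.1 this)) hσ
  refine ⟨t, ht, fun x => (H x).1.fst, ?_, fun x => ?_, fun x => ⟨?_, ?_⟩⟩
  · exact (WithLp.continuous_fst 2 X ℝ).comp (continuous_subtype_val.comp hH)
  · simp only [hHν]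
    rfl
  · exact (WithLp.dist_fst_le (H x).1 (levelPoint F (g x) T (hT x)).1).trans (hHx x).1
  · exact (H x).2.trans (EReal.coe_le_coe_iff.2 (hHx x).2)

/-- Without critical points at level `c`, the weak slope of the height function is bounded away from
zero on the part of the epigraph near this level. -/
lemma exists_slope_bound (hlsc : LowerSemicontinuous F) (hPS : PalaisSmale F)
    (hepi : EpiCondition F) {c : ℝ}
    (hc : ∀ u, F u = (c : EReal) → ¬IsCriticalPoint F u) :
    ∃ σ : ℝ≥0, 0 < σ ∧ ∃ τ : ℝ, 0 < τ ∧ ∀ T : ℝ, |T - c| ≤ τ → ∀ (u : X) (h : F u ≤ (T : EReal)),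
      (σ : ℝ≥0∞) < weakSlope (epiHeight F) (levelPoint F u T h) := by
  by_contra! hcon
  have hseq : ∀ n : ℕ, ∃ (T : ℝ) (u : X) (h : F u ≤ (T : EReal)), |T - c| ≤ 1 / ((n : ℝ) + 1) ∧
      weakSlope (epiHeight F) (levelPoint F u T h) ≤ ENNReal.ofReal (1 / ((n : ℝ) + 1)) := by
    intro n
    have hn : 0 < 1 / ((n : ℝ) + 1) := Nat.one_div_pos_of_nat
    obtain ⟨T, hT, u, h, hs⟩ := hcon (Real.toNNReal (1 / ((n : ℝ) + 1)))
      (Real.toNNReal_pos.2 hn) _ hn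
    exact ⟨T, u, h, hT, hs⟩
  choose T u h hT hs using hseq
  have hlim := tendsto_one_div_add_atTop_nhds_zero_nat (𝕜 := ℝ)
  have hTc : Tendsto T atTop (𝓝 c) := by
    rw [tendsto_iff_dist_tendsto_zero]
    exact squeeze_zero (fun _ => dist_nonneg) (fun n => by rw [Real.dist_eq]; exact hT n) hlim
  have hs0 : Tendsto (fun n => weakSlope (epiHeight F) (levelPoint F (u n) (T n) (h n)))
      atTop (𝓝 0) := by
    refine tendsto_of_tendsto_of_tendsto_of_le_of_le tendsto_const_nhds ?_ (fun _ => zero_le) hs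
    simpa using ENNReal.tendsto_ofReal hlim
  have heq : ∀ᶠ n in atTop, F (u n) = (T n : EReal) := by
    have hb := hepi (|c| + 2) (by positivity)
    filter_upwards [hs0.eventually (gt_mem_nhds hb)] with n hn
    by_contra hne
    have hlt : F (u n) < (T n : EReal) := lt_of_le_of_ne (h n) hne
    have hTb : |T n| < |c| + 2 := by
      have h1 : 1 / ((n : ℝ) + 1) ≤ 1 := by
        rw [div_le_one (by positivity)]
        linarith [n.cast_nonneg (α := ℝ)]
      have h2 := abs_sub_abs_le_abs_sub (T n) c
      linarith [hT n]
    exact absurd (iInf₂_le (levelPoint F (u n) (T n) (h n)) ⟨hlt, hTb⟩) (not_le.2 hn)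
  have hFc : Tendsto (fun n => F (u n)) atTop (𝓝 (c : EReal)) :=
    (EReal.tendsto_coe.2 hTc).congr' (heq.mono fun n hn => hn.symm)
  have hslope : Tendsto (fun n => lscWeakSlope F (u n)) atTop (𝓝 0) := by
    have h2 : Tendsto (fun n => 2 * weakSlope (epiHeight F) (levelPoint F (u n) (T n) (h n)))
        atTop (𝓝 0) := by
      simpa using ENNReal.Tendsto.const_mul (a := 2) hs0 (Or.inr ENNReal.ofNat_ne_top)
    refine tendsto_of_tendsto_of_tendsto_of_le_of_le' tendsto_const_nhds h2
      (Eventually.of_forall fun _ => zero_le) ?_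
    have hhalf : (0 : ℝ≥0∞) < 1 / 2 := by simp
    filter_upwards [heq, hs0.eventually (gt_mem_nhds hhalf)] with n hn hn'
    have hu : F (u n) ≠ ⊤ := by rw [hn]; exact EReal.coe_ne_top _
    rw [levelPoint_eq_graphPoint hn hu] at hn' ⊢
    exact lscWeakSlope_le hu hn'.le
  obtain ⟨φ, x, hφ, hx⟩ := hPS c u hFc hslope
  have hφ' := hφ.tendsto_atTop
  have hxc : F x ≤ (c : EReal) := by
    refine le_of_forall_lt fun a ha => ?_
    obtain ⟨b, hab, hb⟩ := exists_between ha
    exact hab.trans_le (ge_of_tendsto (hFc.comp hφ') ((hx.eventually (hlsc x b hb)).mono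
      fun n hn => le_of_lt hn))
  have hpt : Tendsto (fun n => levelPoint F (u (φ n)) (T (φ n)) (h (φ n))) atTop
      (𝓝 (levelPoint F x c hxc)) := by
    rw [tendsto_subtype_rng]
    exact ((WithLp.prod_continuous_toLp 2 X ℝ).tendsto _).comp
      (hx.prodMk_nhds (hTc.comp hφ'))
  have hzero : weakSlope (epiHeight F) (levelPoint F x c hxc) = 0 := by
    by_contra hne
    obtain ⟨a, ha0, ha⟩ := exists_between (pos_iff_ne_zero.2 hne)
    obtain ⟨n, hn1, hn2⟩ := ((hpt.eventually (lowerSemicontinuous_weakSlope _ _ a ha)).and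
      ((hs0.comp hφ').eventually (gt_mem_nhds ha0))).exists
    exact lt_asymm hn1 hn2
  have hFx : F x = (c : EReal) := by
    by_contra hne
    exact (weakSlope_pos_of_lt hepi (lt_of_le_of_ne hxc hne)).ne' hzero
  exact hc x hFx (isCriticalPoint_of_weakSlope_eq_zero hFx hzero)

end Epigraph

/-! ### Genus -/

section Genus

variable {X : Type*} [NormedAddCommGroup X] {S : Set X}

lemma le_genus_iff {k : ℕ} : (k : ℕ∞) ≤ genus S ↔
    ∀ (n : ℕ) (φ : X → EuclideanSpace ℝ (Fin n)), ContinuousOn φ S →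
      (∀ x ∈ S, φ (-x) = -φ x ∧ φ x ≠ 0) → k ≤ n := by
  rw [genus, le_iInf₂_iff]
  simp only [Nat.cast_le]
  exact ⟨fun h n φ h1 h2 => h n ⟨φ, h1, h2⟩, fun h n ⟨φ, h1, h2⟩ => h n φ h1 h2⟩

/-- The image of a compact symmetric set under an odd continuous map without zeros has at least the
same genus. -/
lemma range_mem_genusClass {k : ℕ} (hS : S ∈ genusClass X k) {g : S → X} (hg : Continuous g)
    (hodd : ∀ x : S, g ⟨-x, hS.2.1 x x.2⟩ = -g x) (hne : ∀ x, g x ≠ 0) :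
    range g ∈ genusClass X k := by
  have : CompactSpace S := isCompact_iff_compactSpace.1 hS.2.2.1
  refine ⟨fun ⟨x, hx⟩ => hne x hx, ?_, isCompact_range hg, le_genus_iff.2 fun n φ hφ h => ?_⟩
  · rintro _ ⟨x, rfl⟩
    exact ⟨_, hodd x⟩
  · classical
    obtain ⟨ψ, hψ⟩ : ∃ ψ : X → EuclideanSpace ℝ (Fin n), ∀ x : S, ψ x = φ (g x) :=
      ⟨fun x => if h : x ∈ S then φ (g ⟨x, h⟩) else 0, fun x => dif_pos x.2⟩
    refine le_genus_iff.1 hS.2.2.2 n ψ ?_ fun x hx => ⟨?_, ?_⟩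
    · rw [continuousOn_iff_continuous_domRestrict]
      exact (hφ.comp_continuous hg mem_range_self).congr fun x => (hψ x).symm
    · rw [hψ ⟨-x, hS.2.1 x hx⟩, hψ ⟨x, hx⟩, hodd ⟨x, hx⟩]
      exact (h _ (mem_range_self _)).1
    · rw [hψ ⟨x, hx⟩]
      exact (h _ (mem_range_self _)).2

/-- By the Borsuk–Ulam theorem, an odd image of the sphere in `ℝᵏ` has genus at least `k`. -/
lemma range_sphere_mem_genusClass {k : ℕ}
    {Φ : Metric.sphere (0 : EuclideanSpace ℝ (Fin k)) 1 → X} (hΦ : Continuous Φ)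
    (hodd : ∀ x, Φ (-x) = -Φ x) (hne : ∀ x, Φ x ≠ 0) : range Φ ∈ genusClass X k := by
  have : CompactSpace (Metric.sphere (0 : EuclideanSpace ℝ (Fin k)) 1) :=
    isCompact_iff_compactSpace.1 (isCompact_sphere _ _)
  refine ⟨fun ⟨x, hx⟩ => hne x hx, ?_, isCompact_range hΦ, le_genus_iff.2 fun n φ hφ h => ?_⟩
  · rintro _ ⟨x, rfl⟩
    exact ⟨_, hodd x⟩
  · refine BorsukUlam.le_of_odd_on_sphere (fun x => φ (Φ x))
      (hφ.comp_continuous hΦ mem_range_self) (fun x => ?_) fun x => (h _ (mem_range_self _)).2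
    rw [hodd]
    exact (h _ (mem_range_self _)).1

lemma genusClass_nonempty {k : ℕ} (hk : 1 ≤ k) (hS : S ∈ genusClass X k) : S.Nonempty := by
  by_contra hne
  rw [not_nonempty_iff_eq_empty] at hne
  subst hne
  have := le_genus_iff.1 hS.2.2.2 0 (fun _ => 0) (continuousOn_empty _) (by simp)
  omega

/-- A compact symmetric set that does not contain the origin has finite genus: the balls
`B(p, ‖p‖)` and `B(-p, ‖p‖)` are disjoint, and bump functions on finitely many such pairs provide
the components of an odd map. -/
lemma exists_genus_bound [NormedSpace ℝ X] {K : Set X} (hK : IsCompact K) (h0 : (0 : X) ∉ K) :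
    ∃ N : ℕ, ∀ (S : Set X) (k : ℕ), S ⊆ K → S ∈ genusClass X k → k ≤ N := by
  obtain ⟨s, hsK, hs⟩ := hK.elim_nhds_subcover (fun p => Metric.ball p ‖p‖) fun p hp =>
    Metric.ball_mem_nhds p (norm_pos_iff.2 fun h => h0 (h ▸ hp))
  set b : X → X → ℝ := fun p x => max 0 (‖p‖ - dist x p) - max 0 (‖p‖ - dist x (-p)) with hb
  have hbc : ∀ p, Continuous (b p) := fun p => by
    simp only [hb]
    fun_prop
  have hbodd : ∀ p x, b p (-x) = -b p x := fun p x => by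
    have h1 : dist (-x) p = dist x (-p) := by rw [← dist_neg_neg, neg_neg]
    have h2 : dist (-x) (-p) = dist x p := dist_neg_neg x p
    simp only [hb, h1, h2]
    ring
  refine ⟨s.card, fun S k hSK hS => ?_⟩
  refine le_genus_iff.1 hS.2.2.2 s.card
    (fun x => WithLp.toLp 2 fun i => b (s.equivFin.symm i) x) ?_ fun x hx => ⟨?_, fun h => ?_⟩
  · exact ((PiLp.continuous_toLp 2 _).comp (continuous_pi fun i => hbc _)).continuousOn
  · ext i
    exact hbodd _ x
  · obtain ⟨p, hp, hxp⟩ := mem_iUnion₂.1 (hs (hSK hx))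
    have hbp : b p x = 0 := by
      have := congrArg (fun w : EuclideanSpace ℝ (Fin s.card) => w (s.equivFin ⟨p, hp⟩)) h
      simpa using this
    have h1 : dist x p < ‖p‖ := hxp
    have h2 : ‖p‖ ≤ dist x (-p) := by
      have h3 : dist p (-p) = 2 * ‖p‖ := by
        rw [dist_eq_norm, sub_neg_eq_add, ← two_smul ℝ p, norm_smul, Real.norm_two]
      have := dist_triangle_left p (-p) x
      linarith
    simp only [hb] at hbp
    rw [max_eq_right (by linarith), max_eq_left (by linarith)] at hbp
    linarith

/-- Continuity of the genus: an odd map without zeros on a closed symmetric set extends to an odd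
continuous map on `X`, without zeros in a neighbourhood. -/
lemma exists_odd_extension [NormedSpace ℝ X] (hS : IsClosed S)
    (hsymm : ∀ x ∈ S, -x ∈ S) {n : ℕ} {φ : X → EuclideanSpace ℝ (Fin n)} (hφ : ContinuousOn φ S)
    (hodd : ∀ x ∈ S, φ (-x) = -φ x) :
    ∃ ψ : X → EuclideanSpace ℝ (Fin n), Continuous ψ ∧ (∀ x, ψ (-x) = -ψ x) ∧
      ∀ x ∈ S, ψ x = φ x := by
  have hc : Continuous fun x : S => WithLp.ofLp (φ x) :=
    (PiLp.continuous_ofLp 2 _).comp (continuousOn_iff_continuous_domRestrict.1 hφ)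
  obtain ⟨e, he⟩ := ContinuousMap.exists_restrict_eq hS (⟨_, hc⟩ : C(S, Fin n → ℝ))
  have heS : ∀ x ∈ S, WithLp.toLp 2 (e x) = φ x := fun x hx => by
    have : e x = WithLp.ofLp (φ x) := DFunLike.congr_fun he ⟨x, hx⟩
    rw [this]
  have hec : Continuous fun x => (WithLp.toLp 2 (e x) : EuclideanSpace ℝ (Fin n)) :=
    (PiLp.continuous_toLp 2 _).comp e.continuous
  refine ⟨fun x => (1 / 2 : ℝ) • (WithLp.toLp 2 (e x) - WithLp.toLp 2 (e (-x))), ?_, fun x => ?_,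
    fun x hx => ?_⟩
  · exact (hec.sub (hec.comp continuous_neg)).const_smul (1 / 2 : ℝ)
  · simp only [neg_neg]
    rw [← smul_neg, neg_sub]
  · simp only [heS x hx, heS _ (hsymm x hx), hodd x hx, sub_neg_eq_add]
    rw [← two_smul ℝ (φ x), smul_smul]
    norm_num

end Genus

/-! ### Minimax values -/

section Minimax

variable {X : Type*} [NormedAddCommGroup X] {F : X → EReal}

lemma minimaxValue_le {k : ℕ} {S : Set X} (hS : S ∈ genusClass X k) {a : EReal}
    (h : ∀ x ∈ S, F x ≤ a) : minimaxValue F k ≤ a :=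
  (iInf₂_le S hS).trans (sSup_le (by rintro _ ⟨x, hx, rfl⟩; exact h x hx))

lemma exists_mem_genusClass_of_minimaxValue_lt {k : ℕ} {a : EReal} (h : minimaxValue F k < a) :
    ∃ S ∈ genusClass X k, ∀ x ∈ S, F x < a := by
  obtain ⟨S, hS⟩ := iInf_lt_iff.1 h
  obtain ⟨hSk, hS⟩ := iInf_lt_iff.1 hS
  exact ⟨S, hSk, fun x hx => (le_sSup (mem_image_of_mem F hx)).trans_lt hS⟩

lemma exists_minimaxValue_eq_coe (hzero : F 0 = ⊤) {m : ℝ} (hm : ∀ u, (m : EReal) ≤ F u) {k : ℕ}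
    (hk : 1 ≤ k) {Φ : Metric.sphere (0 : EuclideanSpace ℝ (Fin k)) 1 → X} (hΦ : Continuous Φ)
    (hodd : ∀ x, Φ (-x) = -Φ x) (hsup : sSup (range (F ∘ Φ)) < ⊤) :
    ∃ c : ℝ, minimaxValue F k = (c : EReal) := by
  have hle : ∀ x, F (Φ x) ≤ sSup (range (F ∘ Φ)) := fun x => le_sSup (mem_range_self x)
  have hne : ∀ x, Φ x ≠ 0 := fun x hx => by
    have := hle x
    rw [hx, hzero] at this
    exact (this.trans_lt hsup).ne rfl
  have htop : minimaxValue F k ≠ ⊤ := by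
    refine ((minimaxValue_le (range_sphere_mem_genusClass hΦ hodd hne) ?_).trans_lt hsup).ne
    rintro _ ⟨x, rfl⟩
    exact hle x
  have hbot : minimaxValue F k ≠ ⊥ := by
    refine ((EReal.bot_lt_coe m).trans_le (le_iInf₂ fun S hS => ?_)).ne'
    obtain ⟨x, hx⟩ := genusClass_nonempty hk hS
    exact (hm x).trans (le_sSup (mem_image_of_mem F hx))
  exact ⟨(minimaxValue F k).toReal, (EReal.coe_toReal htop hbot).symm⟩

variable [NormedSpace ℝ X]

/-- If there were no critical point at the minimax level `c`, then Ekeland's principle, applied to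
the pairs `(g, T)` of an odd map `g` on a set of the class and a bound `T` of `F ∘ g`, would give a
pair that cannot be improved by a deformation. -/
lemma exists_criticalPoint_of_minimaxValue [CompleteSpace X] (hlsc : LowerSemicontinuous F)
    (heven : ∀ u, F (-u) = F u) (hzero : F 0 = ⊤) (hPS : PalaisSmale F) (hepi : EpiCondition F)
    {k : ℕ} {c : ℝ} (hc : minimaxValue F k = (c : EReal)) :
    ∃ u, F u = (c : EReal) ∧ IsCriticalPoint F u := by
  by_contra! hcon
  obtain ⟨σ₀, hσ₀, τ, hτ, hslope⟩ := exists_slope_bound hlsc hPS hepi hcon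
  -- The metric on pairs is the maximum metric, and `σ ≤ 1` controls the second component.
  set σ : ℝ≥0 := min σ₀ 1 with hσ
  have hσpos : 0 < σ := lt_min hσ₀ one_pos
  have hσ1 : (σ : ℝ) ≤ 1 := by exact_mod_cast min_le_right σ₀ 1
  have hσσ₀ : (σ : ℝ≥0∞) ≤ σ₀ := by exact_mod_cast min_le_left σ₀ 1
  obtain ⟨S, hS, hSF⟩ := exists_mem_genusClass_of_minimaxValue_lt (F := F) (k := k)
    (a := ((c + τ : ℝ) : EReal)) (by rw [hc]; exact_mod_cast lt_add_of_pos_right c hτ)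
  have : CompactSpace S := isCompact_iff_compactSpace.1 hS.2.2.1
  set ν : S → S := fun x => ⟨-x, hS.2.1 x x.2⟩ with hν
  set A : Set (C(S, X) × ℝ) :=
    {y | (∀ x, y.1 (ν x) = -y.1 x ∧ F (y.1 x) ≤ (y.2 : EReal)) ∧ y.2 ≤ c + τ} with hA
  have hAc : ∀ y ∈ A, c ≤ y.2 := by
    intro y hy
    have hmem : range y.1 ∈ genusClass X k :=
      range_mem_genusClass hS y.1.continuous (fun x => (hy.1 x).1) fun x hx => by
        have := (hy.1 x).2
        rw [hx, hzero] at this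
        exact EReal.coe_ne_top _ (top_le_iff.1 this)
    have := minimaxValue_le (F := F) (a := (y.2 : EReal)) hmem
      (by rintro _ ⟨x, rfl⟩; exact (hy.1 x).2)
    rw [hc] at this
    exact_mod_cast this
  have hAclosed : IsClosed A := by
    have heval : ∀ x : S, Continuous fun y : C(S, X) × ℝ => y.1 x := fun x =>
      (continuous_eval_const x).comp continuous_fst
    have h1 : IsClosed {y : C(S, X) × ℝ | ∀ x, y.1 (ν x) = -y.1 x ∧ F (y.1 x) ≤ (y.2 : EReal)} := by
      simp only [ofPred_forall]
      refine isClosed_iInter fun x => ?_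
      refine (isClosed_eq (heval _) (heval _).neg).inter ?_
      exact hlsc.isClosed_epigraph.preimage
        ((heval x).prodMk (continuous_coe_real_ereal.comp continuous_snd))
    exact h1.inter (isClosed_le continuous_snd continuous_const)
  have hAne : A.Nonempty :=
    ⟨(⟨Subtype.val, continuous_subtype_val⟩, c + τ),
      fun x => ⟨rfl, (hSF x x.2).le⟩, le_rfl⟩
  obtain ⟨y, hyA, hy⟩ := exists_ekeland_point (T := Prod.snd) continuous_snd hAclosed hAne hAc
    (σ := σ) (by exact_mod_cast hσpos)
  have hyc := hAc y hyA
  obtain ⟨t, ht, g, hg, hgν, hgx⟩ := exists_odd_deformation heven hzero y.1.continuous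
    (fun x => (hyA.1 x).1) (fun x => (hyA.1 x).2) (σ := σ) fun x =>
      hσσ₀.trans_lt (hslope y.2 (by rw [abs_le]; constructor <;> linarith [hyA.2]) _ _)
  have hσt : 0 < (σ : ℝ) * t := mul_pos (by exact_mod_cast hσpos) ht
  have hz := hy (⟨g, hg⟩, y.2 - σ * t)
    ⟨fun x => ⟨hgν x, (hgx x).2⟩, (sub_le_self _ hσt.le).trans hyA.2⟩ (by
      have hdist : dist y ((⟨g, hg⟩ : C(S, X)), y.2 - σ * t) ≤ t := by
        rw [Prod.dist_eq]
        refine max_le ((ContinuousMap.dist_le ht.le).2 fun x => ?_) ?_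
        · rw [dist_comm]; exact (hgx x).1
        · rw [Real.dist_eq, sub_sub_cancel, abs_of_pos hσt]
          exact mul_le_of_le_one_left ht.le hσ1
      have := mul_le_mul_of_nonneg_left hdist σ.coe_nonneg
      simpa using this)
  have := congrArg Prod.snd hz
  simp only at this
  linarith

/-- On an optimal set `S`, the weak slope of the height function cannot be positive at all points
`(v, c)`, `v ∈ S`, since otherwise a deformation would improve `S`. -/
lemma exists_criticalPoint_of_optimal (heven : ∀ u, F (-u) = F u) (hzero : F 0 = ⊤)
    (hepi : EpiCondition F) {k : ℕ} (hk : 1 ≤ k) {c : ℝ} (hc : minimaxValue F k = (c : EReal))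
    {S : Set X} (hS : S ∈ genusClass X k) (hSc : sSup (F '' S) = (c : EReal)) :
    ∃ v ∈ S, F v = (c : EReal) ∧ IsCriticalPoint F v := by
  by_contra! hcon
  have : CompactSpace S := isCompact_iff_compactSpace.1 hS.2.2.1
  have : Nonempty S := (genusClass_nonempty hk hS).to_subtype
  have hle : ∀ x : S, F x ≤ (c : EReal) := fun x =>
    (le_sSup (mem_image_of_mem F x.2)).trans hSc.le
  have hpos : ∀ x : S, 0 < weakSlope (epiHeight F) (levelPoint F x c (hle x)) := by
    intro x
    rcases (hle x).lt_or_eq with h | h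
    · exact weakSlope_pos_of_lt hepi h
    · exact pos_iff_ne_zero.2 fun h0 => hcon x x.2 h (isCriticalPoint_of_weakSlope_eq_zero h h0)
  have hlsc : LowerSemicontinuous fun x : S =>
      weakSlope (epiHeight F) (levelPoint F (x : X) c (hle x)) :=
    (lowerSemicontinuous_weakSlope _).comp (Continuous.subtype_mk
      ((WithLp.prod_continuous_toLp 2 X ℝ).comp (continuous_subtype_val.prodMk continuous_const)) _)
  obtain ⟨x₀, -, hmin⟩ := LowerSemicontinuousOn.exists_isMinOn univ_nonempty
    (isCompact_univ (X := S)) (hlsc.lowerSemicontinuousOn _)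
  obtain ⟨σ, hσ0, hσ⟩ := ENNReal.lt_iff_exists_nnreal_btwn.1 (hpos x₀)
  obtain ⟨t, ht, g, hg, hgν, hgx⟩ := exists_odd_deformation heven hzero
    (ν := fun x : S => ⟨-x, hS.2.1 x x.2⟩) (g := Subtype.val) continuous_subtype_val
    (fun _ => rfl) hle (σ := σ) fun x => hσ.trans_le (hmin (mem_univ x))
  have hmem : range g ∈ genusClass X k :=
    range_mem_genusClass hS hg hgν fun x hx => by
      have := (hgx x).2
      rw [hx, hzero] at this
      exact EReal.coe_ne_top _ (top_le_iff.1 this)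
  have := minimaxValue_le (F := F) hmem (by rintro _ ⟨x, rfl⟩; exact (hgx x).2)
  rw [hc, EReal.coe_le_coe_iff] at this
  have hσt : 0 < (σ : ℝ) * t := mul_pos (by exact_mod_cast hσ0) ht
  linarith

lemma tendsto_minimaxValue (hzero : F 0 = ⊤)
    (hcomp : ∀ γ : ℝ, IsCompact {u | F u ≤ (γ : EReal)}) :
    Tendsto (fun k : ℕ => minimaxValue F k) atTop (𝓝 ⊤) := by
  rw [EReal.tendsto_nhds_top_iff_real]
  intro γ
  obtain ⟨N, hN⟩ := exists_genus_bound (hcomp (γ + 1)) (by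
    rw [mem_ofPred_eq, hzero, top_le_iff]
    exact EReal.coe_ne_top _)
  filter_upwards [eventually_gt_atTop N] with k hk
  by_contra! hle
  obtain ⟨S, hS, hSF⟩ := exists_mem_genusClass_of_minimaxValue_lt (F := F) (k := k)
    (a := ((γ + 1 : ℝ) : EReal)) (hle.trans_lt (by exact_mod_cast lt_add_one γ))
  have := hN S k (fun x hx => (hSF x hx).le) hS
  omega

/-- If sublevel sets are compact, then the sublevel set at the minimax level is optimal: an odd map
without zeros on it extends without zeros to a slightly larger sublevel set. -/
lemma sublevel_mem_genusClass (hlsc : LowerSemicontinuous F) (heven : ∀ u, F (-u) = F u)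
    (hzero : F 0 = ⊤) (hcomp : ∀ γ : ℝ, IsCompact {u | F u ≤ (γ : EReal)}) {k : ℕ} {c : ℝ}
    (hc : minimaxValue F k = (c : EReal)) : {u | F u ≤ (c : EReal)} ∈ genusClass X k := by
  have hsymm : ∀ x ∈ {u | F u ≤ (c : EReal)}, -x ∈ {u | F u ≤ (c : EReal)} := fun x hx => by
    rw [mem_ofPred_eq, heven]
    exact hx
  refine ⟨by simp [hzero], hsymm, hcomp c, le_genus_iff.2 fun n φ hφ h => ?_⟩
  obtain ⟨ψ, hψ, hψodd, hψφ⟩ := exists_odd_extension (hcomp c).isClosed hsymm hφ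
    fun x hx => (h x hx).1
  obtain ⟨γ, hγc, hγ⟩ : ∃ γ : ℝ, c < γ ∧ ∀ x, F x < (γ : EReal) → ψ x ≠ 0 := by
    by_cases hne : ({u | F u ≤ ((c + 1 : ℝ) : EReal)} ∩ {x | ψ x = 0}).Nonempty
    · obtain ⟨x₀, hx₀, hmin⟩ := LowerSemicontinuousOn.exists_isMinOn hne
        ((hcomp (c + 1)).inter_right (isClosed_eq hψ continuous_const))
        (hlsc.lowerSemicontinuousOn _)
      have hlt : (c : EReal) < F x₀ := by
        by_contra! hle
        exact (h x₀ hle).2 ((hψφ x₀ hle).symm.trans hx₀.2)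
      obtain ⟨γ, hcγ, hγ⟩ := EReal.lt_iff_exists_real_btwn.1 hlt
      refine ⟨γ, by exact_mod_cast hcγ, fun x hx h0 => ?_⟩
      have hγ1 : (γ : EReal) < ((c + 1 : ℝ) : EReal) := hγ.trans_le hx₀.1
      exact absurd (hmin ⟨(hx.trans hγ1).le, h0⟩) (not_le.2 (hx.trans hγ))
    · refine ⟨c + 1, lt_add_one c, fun x hx h0 => hne ⟨x, hx.le, h0⟩⟩
  obtain ⟨S, hS, hSF⟩ := exists_mem_genusClass_of_minimaxValue_lt (F := F) (k := k)
    (a := (γ : EReal)) (by rw [hc]; exact_mod_cast hγc)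
  exact le_genus_iff.1 hS.2.2.2 n ψ hψ.continuousOn fun x hx => ⟨hψodd x, hγ x (hSF x hx)⟩

end Minimax

end WeakSlopeTheory
end

theorem theorem4p1 {X : Type*} [NormedAddCommGroup X] [NormedSpace ℝ X] [CompleteSpace X]
    (F : X → EReal)
    (hlsc : LowerSemicontinuous F)
    (heven : ∀ u, F (-u) = F u)
    (hzero : F 0 = ⊤)
    (hbdd : ∃ m : ℝ, ∀ u, (m : EReal) ≤ F u)
    (hPS : WeakSlopeTheory.PalaisSmale F)
    (hepi : WeakSlopeTheory.EpiCondition F)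
    (hsphere : ∀ k : ℕ, 1 ≤ k →
      ∃ Φ : Metric.sphere (0 : EuclideanSpace ℝ (Fin k)) 1 → X,
        Function.Injective Φ ∧ Continuous Φ ∧ (∀ x, Φ (-x) = -Φ x) ∧ sSup (Set.range (F ∘ Φ)) < ⊤) :
    (∃ (c : ℕ → ℝ) (u : ℕ → X), ∀ k : ℕ, 1 ≤ k →
      WeakSlopeTheory.minimaxValue F k = (c k : EReal) ∧
      F (u k) = (c k : EReal) ∧ WeakSlopeTheory.IsCriticalPoint F (u k) ∧
      F (-u k) = (c k : EReal) ∧ WeakSlopeTheory.IsCriticalPoint F (-u k)) ∧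
    ((∀ γ : ℝ, IsCompact {u | F u ≤ (γ : EReal)}) →
      Tendsto (fun k : ℕ => WeakSlopeTheory.minimaxValue F k) atTop (𝓝 ⊤) ∧
      ∀ k : ℕ, 1 ≤ k →
        (∃ S ∈ WeakSlopeTheory.genusClass X k,
          sSup (F '' S) = WeakSlopeTheory.minimaxValue F k) ∧
        ∀ S ∈ WeakSlopeTheory.genusClass X k,
          sSup (F '' S) = WeakSlopeTheory.minimaxValue F k →
          ∃ v ∈ S, F v = WeakSlopeTheory.minimaxValue F k ∧
            WeakSlopeTheory.IsCriticalPoint F v) := by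
  have hfin : ∀ k : ℕ, 1 ≤ k →
      ∃ c : ℝ, WeakSlopeTheory.minimaxValue F k = (c : EReal) := fun k hk => by
    obtain ⟨m, hm⟩ := hbdd
    obtain ⟨Φ, -, hΦ, hodd, hsup⟩ := hsphere k hk
    exact WeakSlopeTheory.exists_minimaxValue_eq_coe hzero hm hk hΦ hodd hsup
  refine ⟨?_, fun hcomp => ⟨WeakSlopeTheory.tendsto_minimaxValue hzero hcomp, fun k hk => ?_⟩⟩
  · have hcrit : ∀ k : ℕ, ∃ (c : ℝ) (u : X), 1 ≤ k →
        WeakSlopeTheory.minimaxValue F k = (c : EReal) ∧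
        F u = (c : EReal) ∧ WeakSlopeTheory.IsCriticalPoint F u := fun k => by
      by_cases hk : 1 ≤ k
      · obtain ⟨c, hc⟩ := hfin k hk
        obtain ⟨u, hu, hcu⟩ := WeakSlopeTheory.exists_criticalPoint_of_minimaxValue hlsc heven
          hzero hPS hepi hc
        exact ⟨c, u, fun _ => ⟨hc, hu, hcu⟩⟩
      · exact ⟨0, 0, fun h => absurd h hk⟩
    choose c u hcu using hcrit
    refine ⟨c, u, fun k hk => ?_⟩
    obtain ⟨h1, h2, h3⟩ := hcu k hk
    exact ⟨h1, h2, h3, (heven _).trans h2, (WeakSlopeTheory.lscWeakSlope_neg heven _).trans h3⟩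
  · obtain ⟨c, hc⟩ := hfin k hk
    have hmem := WeakSlopeTheory.sublevel_mem_genusClass hlsc heven hzero hcomp hc
    refine ⟨⟨_, hmem, le_antisymm ?_ (iInf₂_le _ hmem)⟩, fun S hS hSc => ?_⟩
    · rw [hc]
      refine sSup_le ?_
      rintro _ ⟨x, hx, rfl⟩
      exact hx
    · rw [hc] at hSc ⊢
      exact WeakSlopeTheory.exists_criticalPoint_of_optimal heven hzero hepi hk hc hS hSc
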